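/- Let $X\subset\mathbb R^n$ be compact, let $\Omega=C([0,1];X)$ carry the uniform distance, and let $\mu_0,\mu_1$ be Borel probability measures on $X$. Let $\Pi_{\rm path}(\mu_0,\mu_1)$ be the set of Borel probability measures $\pi$ on $\Omega$ whose images under $\gamma\mapsto\gamma(0)$ and $\gamma\mapsto\gamma(1)$ are $\mu_0$ and $\mu_1$. Let $c:\Omega\to(-\infty,+\infty]$ be bounded from below, lower semicontinuous and coercive, i.e. $\{\gamma\in\Omega:|\gamma(0)|\le M,\ c(\gamma)\le N\}$ is compact for all $M,N>0$. Put $c_{\mathbf e}(x,y)=\inf\{c(\gamma):\gamma(0)=x,\ \gamma(1)=y\}$ and assume that $c_{\mathbf e}(x,y)\le f(x)+g(y)$ for all $x,y\in X$, for some real-valued $f\in L^1(\mu_0)$, $g\in L^1(\mu_1)$. For $\theta,\beta>0$ let $$\mathcal K(\gamma,\sigma)=\int_0^1\theta e^{-\beta|\gamma(t)-\sigma(t)|^2}\,dt,\qquad \mathcal U(\gamma;\pi)=\int_\Omega\mathcal K(\gamma,\sigma)\,d\pi(\sigma).$$ The primal problem is to minimize $$\mathcal F(\pi)=\int_\Omega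 c\,d\pi+\int_\Omega\mathcal U(\gamma;\pi)\,d\pi(\gamma)$$ over $\pi\in\Pi_{\rm path}(\mu_0,\mu_1)$. Put $\mathcal E(\pi)=\int_\Omega c\,d\pi+\int_\Omega 2\,\mathcal U(\gamma;\pi)\,d\pi(\gamma)$. For a plan $\pi$, the auxiliary dual problem $D_\pi$ is to maximize $\int_X\phi\,d\mu_0+\int_X\psi\,d\mu_1$ over all $(\phi,\psi)\in L^1(\mu_0)\times L^1(\mu_1)$ such that $$\phi(\gamma(0))+\psi(\gamma(1))\le c(\gamma)+2\,\mathcal U(\gamma;\pi)$$ for every $\gamma\in\Omega$ with $\gamma(0)\notin N_0$ and $\gamma(1)\notin N_1$, for some $\mu_0$-null set $N_0$ and some $\mu_1$-null set $N_1$ (which may depend on the pair). Theorem. Suppose that $\pi_0$ solves the primal problem. Then: 1. The auxiliary dual problem $D_{\pi_0}$ has a solution $(\phi_0,\psi_0)$. 2. The value of $D_{\pi_0}$ is $\mathcal E(\pi_0)$: every solution satisfies $\int_X\phi_0\,d\mu_0+\int_X\psi_0\,d\mu_1=\mathcal E(\pi_0)$. 3. A pair $(\phi_0,\psi_0)$ that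 is feasible for $D_{\pi_0}$ solves $D_{\pi_0}$ if and only if $\phi_0(\gamma(0))+\psi_0(\gamma(1))=c(\gamma)+2\,\mathcal U(\gamma;\pi_0)$ for $\pi_0$-a.e. $\gamma$. 4. If $\phi_0,\psi_0\in C(X)$ and $(\phi_0,\psi_0)$ maximizes over $C(X)\times C(X)$ the Lagrange dual function $$\mathcal D(\phi,\psi)=\inf_{\pi\ge0}\Big\{\mathcal F(\pi)+\int_X\phi\,d\mu_0-\int_\Omega\phi(\gamma(0))\,d\pi(\gamma)+\int_X\psi\,d\mu_1-\int_\Omega\psi(\gamma(1))\,d\pi(\gamma)\Big\},$$ where $\pi$ runs over all finite nonnegative Borel measures on $\Omega$, then $(\phi_0,\psi_0)$ solves $D_{\pi_0}$. -/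

import Mathlib

open MeasureTheory Set

noncomputable section

namespace PathTransport

/-- The path space `Ω`: continuous maps `[0,1] → X`, with the uniform distance. -/
abbrev PathSpace {n : ℕ} (X : Set (EuclideanSpace ℝ (Fin n))) : Type := C(unitInterval, X)

instance instMeasurableSpacePathSpace {n : ℕ} (X : Set (EuclideanSpace ℝ (Fin n))) :
    MeasurableSpace C(unitInterval, X) := borel C(unitInterval, X)

instance instBorelSpacePathSpace {n : ℕ} (X : Set (EuclideanSpace ℝ (Fin n))) :
    BorelSpace C(unitInterval, X) := ⟨rfl⟩

variable {n : ℕ} {X : Set (EuclideanSpace ℝ (Fin n))}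

/-- `π` is a probability measure on paths whose endpoint marginals are `μ₀` and `μ₁`. -/
def IsAdmissiblePlan (μ₀ μ₁ : Measure X) (π : Measure (PathSpace X)) : Prop :=
  IsProbabilityMeasure π ∧
    π.map (fun γ => γ 0) = μ₀ ∧ π.map (fun γ => γ 1) = μ₁

/-- Path costs with values in `(-∞, +∞]` that are bounded below, lower semicontinuous and
coercive. -/
structure IsCoerciveCost (c : PathSpace X → EReal) : Prop where
  bounded_below : ∃ m : ℝ, ∀ γ, (m : EReal) ≤ c γ
  lowerSemicontinuous : LowerSemicontinuous c
  isCompact_sublevel : ∀ M N : ℝ, 0 < M → 0 < N →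
    IsCompact {γ : PathSpace X | ‖(γ 0 : EuclideanSpace ℝ (Fin n))‖ ≤ M ∧ c γ ≤ (N : EReal)}

/-- The endpoint cost `c_e(x,y)`: the infimum of `c` over the paths from `x` to `y`
(`+∞` if there is no such path). -/
def endpointCost (c : PathSpace X → EReal) (x y : X) : EReal :=
  ⨅ γ : {γ : PathSpace X // γ 0 = x ∧ γ 1 = y}, c γ.1

/-- The integral of an extended-real function, positive part minus negative part. It is used only
for functions that are bounded below and finite measures, where the second term is finite. -/
def costIntegral (c : PathSpace X → EReal) (π : Measure (PathSpace X)) : EReal :=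
  ((∫⁻ γ, (c γ).toENNReal ∂π : ENNReal) : EReal)
    - ((∫⁻ γ, (-c γ).toENNReal ∂π : ENNReal) : EReal)

/-- The Gaussian interaction kernel `K(γ,σ) = ∫₀¹ θ exp(-β |γ(t) - σ(t)|²) dt`. -/
def kernel (θ β : ℝ) (γ σ : PathSpace X) : ℝ :=
  ∫ t : unitInterval, θ * Real.exp (-β *
    ‖(γ t : EuclideanSpace ℝ (Fin n)) - (σ t : EuclideanSpace ℝ (Fin n))‖ ^ 2)

/-- The interaction potential `U(γ; π) = ∫ K(γ,σ) dπ(σ)`. -/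
def potential (θ β : ℝ) (γ : PathSpace X) (π : Measure (PathSpace X)) : ℝ :=
  ∫ σ, kernel θ β γ σ ∂π

/-- The functional `∫ c dπ + ∫ U(γ; π) dπ(γ)` of the optimal path problem with interaction. -/
def interactionFunctional (c : PathSpace X → EReal) (θ β : ℝ) (π : Measure (PathSpace X)) :
    EReal :=
  costIntegral c π + ((∫ γ, potential θ β γ π ∂π : ℝ) : EReal)

/-- The energy `E(π) = ∫ c dπ + ∫ 2 U(γ; π) dπ(γ)`. -/
def energy (c : PathSpace X → EReal) (θ β : ℝ) (π : Measure (PathSpace X)) : EReal :=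
  costIntegral c π + ((∫ γ, 2 * potential θ β γ π ∂π : ℝ) : EReal)

/-- `π₀` solves the primal problem: it minimizes the interaction functional over all admissible
plans. -/
def SolvesPrimal (c : PathSpace X → EReal) (θ β : ℝ) (μ₀ μ₁ : Measure X)
    (π₀ : Measure (PathSpace X)) : Prop :=
  IsAdmissiblePlan μ₀ μ₁ π₀ ∧
    ∀ π, IsAdmissiblePlan μ₀ μ₁ π →
      interactionFunctional c θ β π₀ ≤ interactionFunctional c θ β π

/-- The dual objective `∫ φ dμ₀ + ∫ ψ dμ₁`. -/
def dualValue (μ₀ μ₁ : Measure X) (φ ψ : X → ℝ) : ℝ :=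
  ∫ x, φ x ∂μ₀ + ∫ y, ψ y ∂μ₁

/-- The competitors of the auxiliary dual problem `D_π`: pairs `(φ,ψ) ∈ L¹(μ₀) × L¹(μ₁)` with
`φ(γ(0)) + ψ(γ(1)) ≤ c(γ) + 2 U(γ; π)` for every path `γ` from `x` to `y`, for `μ₀`-a.e. `x` and
`μ₁`-a.e. `y` (that is, outside one `μ₀`-null set of `x` and one `μ₁`-null set of `y`). -/
def AuxFeasible (c : PathSpace X → EReal) (θ β : ℝ) (μ₀ μ₁ : Measure X)
    (π : Measure (PathSpace X)) (φ ψ : X → ℝ) : Prop :=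
  Integrable φ μ₀ ∧ Integrable ψ μ₁ ∧
    ∃ A ∈ ae μ₀, ∃ B ∈ ae μ₁, ∀ γ : PathSpace X, γ 0 ∈ A → γ 1 ∈ B →
      ((φ (γ 0) + ψ (γ 1) : ℝ) : EReal) ≤ c γ + ((2 * potential θ β γ π : ℝ) : EReal)

/-- `(φ,ψ)` solves (attains the supremum in) the auxiliary dual problem `D_π`. -/
def SolvesAuxDual (c : PathSpace X → EReal) (θ β : ℝ) (μ₀ μ₁ : Measure X)
    (π : Measure (PathSpace X)) (φ ψ : X → ℝ) : Prop :=
  AuxFeasible c θ β μ₀ μ₁ π φ ψ ∧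
    ∀ φ' ψ' : X → ℝ, AuxFeasible c θ β μ₀ μ₁ π φ' ψ' →
      dualValue μ₀ μ₁ φ' ψ' ≤ dualValue μ₀ μ₁ φ ψ

/-- The Lagrangian of the primal problem, for a finite measure `π ≥ 0` on paths and continuous
multipliers `φ, ψ` of the two marginal constraints. -/
def lagrangian (c : PathSpace X → EReal) (θ β : ℝ) (μ₀ μ₁ : Measure X)
    (π : Measure (PathSpace X)) (φ ψ : C(X, ℝ)) : EReal :=
  interactionFunctional c θ β π +
    ((∫ x, φ x ∂μ₀ - ∫ γ, φ (γ 0) ∂π + (∫ y, ψ y ∂μ₁ - ∫ γ, ψ (γ 1) ∂π) : ℝ) : EReal)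

/-- The Lagrange dual function: the infimum of the Lagrangian over all finite measures `π ≥ 0`. -/
def dualFunction (c : PathSpace X → EReal) (θ β : ℝ) (μ₀ μ₁ : Measure X)
    (φ ψ : C(X, ℝ)) : EReal :=
  ⨅ π : FiniteMeasure (PathSpace X), lagrangian c θ β μ₀ μ₁ (π : Measure (PathSpace X)) φ ψ

/-- `(φ,ψ)` maximizes the Lagrange dual function. -/
def SolvesDual (c : PathSpace X → EReal) (θ β : ℝ) (μ₀ μ₁ : Measure X)
    (φ ψ : C(X, ℝ)) : Prop :=
  ∀ φ' ψ' : C(X, ℝ), dualFunction c θ β μ₀ μ₁ φ' ψ' ≤ dualFunction c θ β μ₀ μ₁ φ ψ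

end PathTransport

end

open Filter Topology TopologicalSpace BoundedContinuousFunction
open scoped ENNReal NNReal RealInnerProductSpace

/-! The interaction energy is quadratic. Comparing `π₀` with `(1 - t) π₀ + t π` and letting `t → 0`
shows that `π₀` minimizes the linear functional `π ↦ ∫ (c + 2 U(·; π₀)) dπ` among admissible plans
(`SolvesPrimal.linearized`). No convexity is needed for this. What remains is Kantorovich duality
for this one cost, whose value at `π₀` is `E(π₀)`.

`exists_kantorovich_duality` provides that duality. Let `V` be the supremum of the dual over
continuous pairs. Finite-dimensional separation and tightness, the latter from coercivity, give a
plan of cost at most `V`, so there is no gap. The supremum is attained in `L¹`: the slacks `f - φ`,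
`g - ψ` of a maximizing sequence are nonnegative up to a constant shift and bounded in `L¹`.
Minimizing the strictly convex functional `∫ exp (-s)` over near-optimal slacks selects an a.e.
convergent sequence, and Fatou keeps the limit finite and optimal. Integrating the constraint
against `π₀` gives weak duality, and its equality case is complementary slackness.

For the Lagrange dual, the Gaussian kernel is positive semidefinite (`two_mul_interaction_le`), so a
continuous pair feasible for the linearized problem has dual function at least its dual value minus
the interaction energy of `π₀`. Hence the supremum of the dual function is at least `F(π₀)`, and at
a maximizer the Lagrangian is at least `F(π₀)` for every `π ≥ 0`. Testing with `π₀ + t δ_γ` yields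
the constraint at `γ`, and testing with `(1 - t) π₀` yields optimality. -/

theorem tendsto_const_add_one_div_nat (r : ℝ) :
    Tendsto (fun n : ℕ => r + 1 / ((n : ℝ) + 1)) atTop (𝓝 r) := by
  simpa using (tendsto_const_nhds (x := r)).add (tendsto_one_div_add_atTop_nhds_zero_nat (𝕜 := ℝ))

/-! ### Almost everywhere limits in midpoint-closed families -/

theorem exp_sub_exp_sq_eq (s t : ℝ) :
    (Real.exp (-(s / 2)) - Real.exp (-(t / 2))) ^ 2 =
      Real.exp (-s) + Real.exp (-t) - 2 * Real.exp (-((s + t) / 2)) := by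
  have h1 : Real.exp (-s) = Real.exp (-(s / 2)) ^ 2 := by
    rw [← Real.exp_nat_mul]; congr 1; push_cast; ring
  have h2 : Real.exp (-t) = Real.exp (-(t / 2)) ^ 2 := by
    rw [← Real.exp_nat_mul]; congr 1; push_cast; ring
  have h3 : Real.exp (-((s + t) / 2)) = Real.exp (-(s / 2)) * Real.exp (-(t / 2)) := by
    rw [← Real.exp_add]; congr 1; ring
  rw [h1, h2, h3]; ring

/-- A sequence that is Cauchy in `L²` has a subsequence that converges almost everywhere. -/
theorem exists_subseq_tendsto_ae_of_integral_sq {Z : Type*} [MeasurableSpace Z] {ν : Measure Z}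
    {h : ℕ → Z → ℝ} (hh : ∀ n, MemLp (h n) 2 ν) {d : ℕ → ℝ} (hd : Tendsto d atTop (𝓝 0))
    (hdist : ∀ n m, n ≤ m → ∫ z, (h n z - h m z) ^ 2 ∂ν ≤ d n) :
    ∃ (w : Z → ℝ) (k : ℕ → ℕ), StrictMono k ∧
      ∀ᵐ z ∂ν, Tendsto (fun i => h (k i) z) atTop (𝓝 (w z)) := by
  have key : ∀ n m, n ≤ m → dist ((hh n).toLp (h n)) ((hh m).toLp (h m)) ≤ Real.sqrt (d n) := by
    intro n m hnm
    rw [dist_eq_norm, ← MemLp.toLp_sub, Lp.norm_toLp]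
    apply Real.le_sqrt_of_sq_le
    refine le_trans (le_of_eq ?_) (hdist n m hnm)
    have hm := (hh n).sub (hh m)
    rw [hm.eLpNorm_eq_integral_rpow_norm (by norm_num) (by norm_num)]
    have hnn : 0 ≤ ∫ z, (h n z - h m z) ^ 2 ∂ν := integral_nonneg fun z => sq_nonneg _
    simp only [ENNReal.toReal_ofNat, Real.rpow_two, Pi.sub_apply, Real.norm_eq_abs, sq_abs]
    rw [ENNReal.toReal_ofReal (by positivity), ← Real.rpow_natCast, ← Real.rpow_mul hnn]
    norm_num
  have hc : CauchySeq fun n => (hh n).toLp (h n) :=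
    cauchySeq_of_le_tendsto_0' (fun n => Real.sqrt (d n)) key (by
      simpa [Function.comp_def] using (Real.continuous_sqrt.tendsto 0).comp hd)
  obtain ⟨w, hw⟩ := cauchySeq_tendsto_of_complete hc
  obtain ⟨k, hk, hkw⟩ := (tendstoInMeasure_of_tendsto_Lp hw).exists_seq_tendsto_ae
  refine ⟨w, k, hk, ?_⟩
  filter_upwards [hkw, ae_all_iff.2 fun n => (hh n).coeFn_toLp] with z hz hz'
  exact hz.congr fun i => hz' _

/-- Let `S n` be a decreasing sequence of nonempty midpoint-closed sets of nonnegative functions with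
bounded integrals. Then some sequence `s n ∈ S n` converges almost everywhere to a finite limit. -/
theorem exists_ae_tendsto_of_midpoint {Z : Type*} [MeasurableSpace Z] {ν : Measure Z}
    [IsFiniteMeasure ν] {R : ℝ} {S : ℕ → Set (Z → ℝ)} (hanti : Antitone S)
    (hne : ∀ n, (S n).Nonempty) (hmeas : ∀ n, ∀ s ∈ S n, AEStronglyMeasurable s ν)
    (hnn : ∀ n, ∀ s ∈ S n, ∀ z, 0 ≤ s z)
    (hmid : ∀ n, ∀ s ∈ S n, ∀ t ∈ S n, (fun z => (s z + t z) / 2) ∈ S n)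
    (hint : ∀ n, ∀ s ∈ S n, ∫⁻ z, ENNReal.ofReal (s z) ∂ν ≤ ENNReal.ofReal (R + 1 / (n + 1))) :
    ∃ (s : ℕ → Z → ℝ) (a : Z → ℝ), (∀ n, s n ∈ S n) ∧ AEStronglyMeasurable a ν ∧
      (∀ᵐ z ∂ν, Tendsto (fun n => s n z) atTop (𝓝 (a z))) ∧ (∀ᵐ z ∂ν, 0 ≤ a z) ∧
      ∫⁻ z, ENNReal.ofReal (a z) ∂ν ≤ ENNReal.ofReal R := by
  -- `I` is bounded and strictly convex, and its midpoint defect is a squared `L²` distance between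
  -- the functions `exp (-s / 2)`. Near-minimizers of `I` are therefore Cauchy after this change of
  -- variable.
  set I : (Z → ℝ) → ℝ := fun s => ∫ z, Real.exp (-s z) ∂ν with hI
  have hexpm : ∀ n, ∀ s ∈ S n, AEStronglyMeasurable (fun z => Real.exp (-s z)) ν := fun n s hs =>
    Real.continuous_exp.comp_aestronglyMeasurable (hmeas n s hs).neg
  have hexpi : ∀ n, ∀ s ∈ S n, Integrable (fun z => Real.exp (-s z)) ν := fun n s hs =>
    Integrable.of_bound (hexpm n s hs) 1 (Eventually.of_forall fun z => by
      rw [Real.norm_of_nonneg (Real.exp_pos _).le, Real.exp_le_one_iff]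
      linarith [hnn n s hs z])
  have hI0 : ∀ s, 0 ≤ I s := fun s => integral_nonneg fun z => (Real.exp_pos _).le
  have hI1 : ∀ n, ∀ s ∈ S n, I s ≤ ν.real univ := fun n s hs => by
    have : I s ≤ ∫ z, (1 : ℝ) ∂ν := integral_mono (hexpi n s hs) (integrable_const _) fun z => by
      simp only [Real.exp_le_one_iff]; linarith [hnn n s hs z]
    simpa using this
  have hbdd : ∀ n, BddBelow (I '' S n) := fun n => ⟨0, by rintro _ ⟨s, -, rfl⟩; exact hI0 s⟩
  set J : ℕ → ℝ := fun n => sInf (I '' S n) with hJ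
  have hJle : ∀ n, ∀ s ∈ S n, J n ≤ I s := fun n s hs => csInf_le (hbdd n) ⟨s, hs, rfl⟩
  have hJmono : Monotone J := fun n m hnm =>
    csInf_le_csInf (hbdd n) ((hne m).image I) (image_mono (hanti hnm))
  have hJb : BddAbove (range J) := ⟨ν.real univ, by
    rintro _ ⟨n, rfl⟩
    obtain ⟨s, hs⟩ := hne n
    exact (hJle n s hs).trans (hI1 n s hs)⟩
  have hJlim : Tendsto J atTop (𝓝 (⨆ n, J n)) := tendsto_atTop_ciSup hJmono hJb
  have hex : ∀ n : ℕ, ∃ s ∈ S n, I s ≤ J n + 1 / ((n : ℝ) + 1) := fun n => by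
    obtain ⟨_, ⟨s, hs, rfl⟩, h⟩ := exists_lt_of_csInf_lt ((hne n).image I)
      (show J n < J n + 1 / ((n : ℝ) + 1) by linarith [show (0 : ℝ) < 1 / ((n : ℝ) + 1) by positivity])
    exact ⟨s, hs, h.le⟩
  choose s hs hsI using hex
  have hhalfm : ∀ n, AEStronglyMeasurable (fun z => Real.exp (-(s n z / 2))) ν := fun n =>
    (show Continuous fun x : ℝ => Real.exp (-(x / 2)) by fun_prop).comp_aestronglyMeasurable
      (hmeas n _ (hs n))
  have hmem : ∀ n, MemLp (fun z => Real.exp (-(s n z / 2))) 2 ν := fun n =>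
    MemLp.of_bound (hhalfm n) 1 (Eventually.of_forall fun z => by
      rw [Real.norm_of_nonneg (Real.exp_pos _).le, Real.exp_le_one_iff]
      linarith [hnn n _ (hs n) z])
  obtain ⟨w, k, hk, hw⟩ := exists_subseq_tendsto_ae_of_integral_sq hmem
    (d := fun n => ((⨆ n, J n) - J n) + 2 * (1 / ((n : ℝ) + 1))) (by
      have h1 := (tendsto_const_nhds (x := ⨆ n, J n)).sub hJlim
      have h2 := (tendsto_one_div_add_atTop_nhds_zero_nat (𝕜 := ℝ)).const_mul 2
      simpa using h1.add h2) (by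
      intro n m hnm
      have hsm : s m ∈ S n := hanti hnm (hs m)
      have hmidm := hmid n _ (hs n) _ hsm
      -- The squared distance is `I (s n) + I (s m) - 2 I (midpoint)`. The midpoint lies in `S n`,
      -- so its `I` is at least `J n`, while `I (s m) ≤ J m + 1/(m+1)` with `J m ≤ ⨆ J`.
      simp_rw [exp_sub_exp_sq_eq]
      rw [integral_sub (f := fun z => Real.exp (-s n z) + Real.exp (-s m z))
        ((hexpi n _ (hs n)).add (hexpi n _ hsm)) ((hexpi n _ hmidm).const_mul 2), integral_add (hexpi n _ (hs n)) (hexpi n _ hsm),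
        integral_const_mul]
      have h1 := hsI n
      have h2 := hsI m
      have h3 := hJle n _ hmidm
      have h4 : J m ≤ ⨆ n, J n := le_ciSup hJb m
      have h5 : 1 / ((m : ℝ) + 1) ≤ 1 / ((n : ℝ) + 1) := by gcongr
      simp only [hI] at h1 h2 h3
      linarith)
  -- Since `i ≤ k i` and `S` decreases, the subsequence itself is a valid selection.
  have hmemk : ∀ i, s (k i) ∈ S i := fun i => hanti (hk.id_le i) (hs _)
  have hlim : ∫⁻ z, liminf (fun i => ENNReal.ofReal (s (k i) z)) atTop ∂ν ≤ ENNReal.ofReal R := by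
    refine (lintegral_liminf_le' fun i => ?_).trans ?_
    · exact (hmeas _ _ (hs (k i))).aemeasurable.ennreal_ofReal
    · have ht : Tendsto (fun i : ℕ => ENNReal.ofReal (R + 1 / ((i : ℝ) + 1))) atTop
          (𝓝 (ENNReal.ofReal R)) :=
        ENNReal.tendsto_ofReal (tendsto_const_add_one_div_nat R)
      rw [← ht.liminf_eq]
      exact liminf_le_liminf (Eventually.of_forall fun i => hint i _ (hmemk i))
  have hfin : ∀ᵐ z ∂ν, liminf (fun i => ENNReal.ofReal (s (k i) z)) atTop < ∞ := by
    refine ae_lt_top' ?_ (hlim.trans_lt ENNReal.ofReal_lt_top).ne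
    simp_rw [liminf_eq_iSup_iInf_of_nat]
    refine AEMeasurable.iSup fun n => AEMeasurable.biInf _ (to_countable _) fun i _ =>
      (hmeas _ _ (hs (k i))).aemeasurable.ennreal_ofReal
  have hconv : ∀ᵐ z ∂ν, Tendsto (fun i => s (k i) z) atTop (𝓝 (-2 * Real.log (w z))) := by
    filter_upwards [hw, hfin] with z hz hzf
    have hs2 : ∀ i, s (k i) z = -2 * Real.log (Real.exp (-(s (k i) z / 2))) := fun i => by
      rw [Real.log_exp]; ring
    -- A zero limit of `exp (-s / 2)` would mean `s → ∞`, which the finite liminf from Fatou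
    -- excludes at almost every point.
    have hw0 : w z ≠ 0 := by
      intro h0
      rw [h0] at hz
      have hz' : Tendsto (fun i => Real.exp (-(s (k i) z / 2))) atTop (𝓝[>] 0) :=
        tendsto_nhdsWithin_iff.2 ⟨hz, Eventually.of_forall fun i => Real.exp_pos _⟩
      have hl := Real.tendsto_log_nhdsGT_zero.comp hz'
      have : Tendsto (fun i => s (k i) z) atTop atTop := by
        have := hl.const_mul_atBot_of_neg (r := (-2 : ℝ)) (by norm_num)
        refine this.congr fun i => ?_
        simp only [Function.comp]
        exact (hs2 i).symm
      have ht := ENNReal.tendsto_ofReal_atTop.comp this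
      have := ht.liminf_eq
      simp only [Function.comp_def] at this
      rw [this] at hzf
      exact lt_irrefl _ hzf
    refine (((Real.continuousAt_log hw0).tendsto.comp hz).const_mul (-2)).congr fun i => ?_
    simp only [Function.comp]
    exact (hs2 i).symm
  refine ⟨fun i => s (k i), fun z => -2 * Real.log (w z), hmemk, ?_, hconv, ?_, ?_⟩
  · exact aestronglyMeasurable_of_tendsto_ae atTop (fun i => hmeas _ _ (hs (k i))) hconv
  · filter_upwards [hconv] with z hz
    exact ge_of_tendsto' hz fun i => hnn _ _ (hs (k i)) z
  · refine le_trans (le_of_eq (lintegral_congr_ae ?_)) hlim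
    filter_upwards [hconv] with z hz
    exact (ENNReal.tendsto_ofReal hz).liminf_eq.symm

/-! ### Lower semicontinuous integrands and tightness -/

section WeakConvergence

variable {Ω : Type*} [TopologicalSpace Ω] [MeasurableSpace Ω] [BorelSpace Ω]

/-- Superlevel sets of a lower semicontinuous function are open, so the portmanteau inequality
applies to each of them. The layer-cake formula and Fatou in the level variable then transfer it to
integrals. Truncation at `j` makes the integrand finite, as the real layer-cake formula requires,
and monotone convergence removes it. -/
theorem lintegral_le_of_tendsto_of_lowerSemicontinuous [HasOuterApproxClosed Ω]
    {μ : ProbabilityMeasure Ω}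
    {μs : ℕ → ProbabilityMeasure Ω} (hμ : Tendsto μs atTop (𝓝 μ)) {C : Ω → ℝ≥0∞}
    (hC : LowerSemicontinuous C) {r : ℝ≥0∞} (hr : ∀ i, ∫⁻ γ, C γ ∂(μs i : Measure Ω) ≤ r) :
    ∫⁻ γ, C γ ∂(μ : Measure Ω) ≤ r := by
  have htrunc : ∀ (j : ℕ) (ν : Measure Ω), ∫⁻ γ, min (C γ) j ∂ν =
      ∫⁻ t in Ioi (0 : ℝ), ν {γ | ENNReal.ofReal t < min (C γ) j} := by
    intro j ν
    have hne : ∀ γ, min (C γ) j ≠ ∞ := fun γ => ne_top_of_le_ne_top (by simp) (min_le_right _ _)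
    have h1 : ∀ γ, min (C γ) j = ENNReal.ofReal (min (C γ) j).toReal := fun γ =>
      (ENNReal.ofReal_toReal (hne γ)).symm
    rw [lintegral_congr h1, lintegral_eq_lintegral_meas_lt]
    · refine setLIntegral_congr_fun measurableSet_Ioi fun t ht => ?_
      congr 1
      ext γ
      exact (ENNReal.ofReal_lt_iff_lt_toReal (le_of_lt ht) (hne γ)).symm
    · exact Eventually.of_forall fun γ => ENNReal.toReal_nonneg
    · exact (hC.measurable.min measurable_const).ennreal_toReal.aemeasurable
  have hj : ∀ j : ℕ, ∫⁻ γ, min (C γ) j ∂(μ : Measure Ω) ≤ r := by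
    intro j
    have hopen : ∀ t : ℝ, IsOpen {γ | ENNReal.ofReal t < min (C γ) j} := fun t => by
      have : {γ | ENNReal.ofReal t < min (C γ) j} =
          {γ | ENNReal.ofReal t < C γ} ∩ {γ | ENNReal.ofReal t < j} := by
        ext γ; simp
      rw [this]
      exact (hC.isOpen_preimage _).inter isOpen_const
    rw [htrunc]
    calc _ ≤ ∫⁻ t in Ioi (0 : ℝ),
          liminf (fun i => (μs i : Measure Ω) {γ | ENNReal.ofReal t < min (C γ) j}) atTop :=
          lintegral_mono fun t => ProbabilityMeasure.le_liminf_measure_open_of_tendsto hμ (hopen t)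
      _ ≤ liminf (fun i => ∫⁻ t in Ioi (0 : ℝ),
          (μs i : Measure Ω) {γ | ENNReal.ofReal t < min (C γ) j}) atTop :=
          lintegral_liminf_le fun n => Antitone.measurable fun s t hst =>
            measure_mono fun γ hγ => lt_of_le_of_lt (ENNReal.ofReal_le_ofReal hst) hγ
      _ ≤ r := by
          refine liminf_le_of_le (by isBoundedDefault) fun b hb => ?_
          obtain ⟨i, hi⟩ := hb.exists
          refine hi.trans ?_
          rw [← htrunc]
          exact (lintegral_mono fun γ => min_le_left _ _).trans (hr i)
  have hsup : ∀ γ, C γ = ⨆ j : ℕ, min (C γ) j := fun γ => by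
    rw [← inf_iSup_eq, ENNReal.iSup_natCast, inf_top_eq]
  rw [lintegral_congr hsup, lintegral_iSup (fun j => hC.measurable.min measurable_const)
    fun i j hij γ => min_le_min_left _ (by exact_mod_cast hij)]
  exact iSup_le hj

theorem isClosed_setOf_lintegral_le [MetrizableSpace Ω] [SeparableSpace Ω] {C : Ω → ℝ≥0∞}
    (hC : LowerSemicontinuous C) (r : ℝ≥0∞) :
    IsClosed {μ : ProbabilityMeasure Ω | ∫⁻ γ, C γ ∂(μ : Measure Ω) ≤ r} := by
  refine IsSeqClosed.isClosed fun μs μ h hμ => ?_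
  exact lintegral_le_of_tendsto_of_lowerSemicontinuous hμ hC h

/-- By Markov's inequality the mass outside the compact set `{C ≤ n + 1}` is at most `r / (n + 1)`.
This is uniform tightness, so Prokhorov's theorem applies to a closed set of measures. -/
theorem isCompact_setOf_lintegral_le [MetrizableSpace Ω] [SeparableSpace Ω] {C : Ω → ℝ≥0∞}
    (hC : LowerSemicontinuous C) (hK : ∀ N : ℝ≥0, IsCompact {γ | C γ ≤ N}) (r : ℝ≥0) :
    IsCompact {μ : ProbabilityMeasure Ω | ∫⁻ γ, C γ ∂(μ : Measure Ω) ≤ r} := by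
  have hP := isCompact_setOfPred_probabilityMeasure_mass_eq_compl_isCompact_le (E := Ω)
    (u := fun n : ℕ => r / (n + 1)) (K := fun n : ℕ => {γ | C γ ≤ ((n + 1 : ℝ≥0) : ℝ≥0∞)})
    (by simpa [div_eq_mul_inv] using
      (tendsto_one_div_add_atTop_nhds_zero_nat (𝕜 := ℝ≥0)).const_mul r)
    (fun n => hK _) (Or.inr fun m n hmn γ (hγ : C γ ≤ _) => show C γ ≤ _ from hγ.trans (by
      exact_mod_cast add_le_add_left hmn 1))
  refine hP.of_isClosed_subset (isClosed_setOf_lintegral_le hC _) fun μ hμ n => ?_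
  have hmk := mul_meas_ge_le_lintegral (μ := (μ : Measure Ω)) hC.measurable
    (((n + 1 : ℝ≥0) : ℝ≥0∞))
  have hsub : (μ : Measure Ω) {γ | C γ ≤ ((n + 1 : ℝ≥0) : ℝ≥0∞)}ᶜ ≤
      ((r / (n + 1) : ℝ≥0) : ℝ≥0∞) := by
    rw [ENNReal.coe_div (by positivity), ENNReal.le_div_iff_mul_le (by simp) (by simp), mul_comm]
    refine le_trans (le_trans ?_ hmk) hμ
    gcongr
    intro γ hγ
    exact (not_le.1 (show ¬ C γ ≤ _ from hγ)).le
  rw [← ENNReal.coe_le_coe]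
  simpa using hsub

end WeakConvergence

/-! ### Abstract linear-programming duality -/

section Duality

variable {Ω : Type*} [TopologicalSpace Ω] [MeasurableSpace Ω] [BorelSpace Ω]
  {M : Type*} [AddCommGroup M] [Module ℝ M]

/-- The finite-dimensional separation step of the duality: finitely many linear constraints can be
met approximately by a probability measure of cost close to the bound. -/
theorem exists_probabilityMeasure_approx (T : M →ₗ[ℝ] (Ω →ᵇ ℝ)) (L : M →ₗ[ℝ] ℝ) {one : M}
    (hTone : ∀ γ, T one γ = 1) (hLone : L one = 1) {C : Ω → ℝ≥0∞}
    (hCm : Measurable C) {V : ℝ}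
    (hCV : ∀ m, (∀ γ, ENNReal.ofReal (T m γ) ≤ C γ) → L m ≤ V)
    (hC0 : ∀ m, (∀ γ, C γ ≠ ∞ → T m γ ≤ 0) → L m ≤ 0) (F : Finset M) {ε : ℝ} (hε : 0 < ε) :
    ∃ μ : ProbabilityMeasure Ω, (∀ m ∈ F, |∫ γ, T m γ ∂(μ : Measure Ω) - L m| ≤ ε) ∧
      ∫⁻ γ, C γ ∂(μ : Measure Ω) ≤ ENNReal.ofReal (V + ε) := by
  classical
  -- Achievable moment vectors paired with upper bounds on the cost. The set is closed upwards in
  -- the last coordinate, and the claim amounts to `(L, V)` lying in its closure.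
  set A : Set ((F → ℝ) × ℝ) := {v | 0 ≤ v.2 ∧ ∃ μ : ProbabilityMeasure Ω,
    (∀ m : F, ∫ γ, T m γ ∂(μ : Measure Ω) = v.1 m) ∧
      ∫⁻ γ, C γ ∂(μ : Measure Ω) ≤ ENNReal.ofReal v.2} with hA
  have hconv : Convex ℝ A := by
    rintro v ⟨hv0, μ, hμ, hμC⟩ w ⟨hw0, ν, hν, hνC⟩ a b ha hb hab
    refine ⟨add_nonneg (mul_nonneg ha hv0) (mul_nonneg hb hw0), ?_⟩
    have hp : IsProbabilityMeasure
        (ENNReal.ofReal a • (μ : Measure Ω) + ENNReal.ofReal b • (ν : Measure Ω)) := ⟨by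
      simp [← ENNReal.ofReal_add ha hb, hab]⟩
    refine ⟨⟨_, hp⟩, fun m => ?_, ?_⟩
    · have h1 : Integrable (T m) (μ : Measure Ω) := (T m).integrable _
      have h2 : Integrable (T m) (ν : Measure Ω) := (T m).integrable _
      simp only [ProbabilityMeasure.coe_mk]
      rw [integral_add_measure (h1.smul_measure ENNReal.ofReal_ne_top)
        (h2.smul_measure ENNReal.ofReal_ne_top), integral_smul_measure, integral_smul_measure,
        hμ, hν, ENNReal.toReal_ofReal ha, ENNReal.toReal_ofReal hb]
      rfl
    · simp only [ProbabilityMeasure.coe_mk]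
      rw [lintegral_add_measure, lintegral_smul_measure, lintegral_smul_measure]
      simp only [Prod.snd_add, Prod.smul_snd, smul_eq_mul]
      rw [ENNReal.ofReal_add (mul_nonneg ha hv0) (mul_nonneg hb hw0), ENNReal.ofReal_mul ha,
        ENNReal.ofReal_mul hb]
      gcongr
  have hdirac : ∀ γ, ∀ r : ℝ, 0 ≤ r → C γ ≤ ENNReal.ofReal r →
      ((fun m : F => T m γ), r) ∈ A := by
    intro γ r hr hCr
    refine ⟨hr, ⟨Measure.dirac γ, inferInstance⟩, fun m => ?_, ?_⟩
    · exact integral_dirac' _ _ (T m).continuous.stronglyMeasurable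
    · simpa only [ProbabilityMeasure.coe_mk, lintegral_dirac' γ hCm] using hCr
  obtain ⟨γ₀, hγ₀⟩ : ∃ γ, C γ ≠ ∞ := by
    by_contra! h
    linarith [hC0 one fun γ hγ => absurd (h γ) hγ]
  have hmem : ((fun m : F => L m), V) ∈ closure A := by
    by_contra hnot
    obtain ⟨l, u, hlt, hgt⟩ := geometric_hahn_banach_point_closed hconv.closure isClosed_closure hnot
    set lam := l (0, 1) with hlam
    set a : F → ℝ := fun i => l (Pi.single i 1, 0) with ha
    have hl : ∀ v : F → ℝ, ∀ r : ℝ, l (v, r) = ∑ i, a i * v i + lam * r := by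
      intro v r
      have h1 : (v, r) = ∑ i, v i • ((Pi.single i 1 : F → ℝ), (0 : ℝ)) + r • ((0 : F → ℝ), (1 : ℝ)) := by
        ext i
        · simp [Prod.fst_sum, Finset.sum_apply, Pi.single_apply]
        · simp [Prod.snd_sum]
      rw [h1, map_add, map_sum, map_smul]
      simp_rw [map_smul, smul_eq_mul]
      simp only [ha, hlam, mul_comm]
    set m : M := ∑ i : F, a i • (i : M) with hm
    have hTm : ∀ γ, T m γ = ∑ i : F, a i * T i γ := fun γ => by
      simp [hm, map_sum, BoundedContinuousFunction.sum_apply]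
    have hLm : L m = ∑ i : F, a i * L i := by simp [hm, map_sum]
    rw [hl, ← hLm] at hlt
    have hgt' : ∀ γ, ∀ r : ℝ, 0 ≤ r → C γ ≤ ENNReal.ofReal r → u < T m γ + lam * r := by
      intro γ r hr hCr
      have := hgt _ (subset_closure (hdirac γ r hr hCr))
      rwa [hl, ← hTm] at this
    -- The cost bound of a fixed Dirac mass can be raised freely, so a negative last coefficient
    -- would violate the separation.
    have hlam0 : 0 ≤ lam := by
      by_contra! hneg
      set r := max (C γ₀).toReal ((u - T m γ₀) / lam) with hr
      have h1 := hgt' γ₀ r (ENNReal.toReal_nonneg.trans (le_max_left _ _))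
        (ENNReal.le_ofReal_iff_toReal_le hγ₀ (ENNReal.toReal_nonneg.trans (le_max_left _ _)) |>.2
          (le_max_left _ _))
      have h2 : (u - T m γ₀) / lam ≤ r := le_max_right _ _
      rw [div_le_iff_of_neg hneg] at h2
      linarith
    -- A vertical hyperplane contradicts `hC0`. Otherwise dividing `u • one - m` by `lam` gives a
    -- dual competitor of value greater than `V`, against `hCV`.
    rcases hlam0.eq_or_lt with h0 | hpos
    · have := hC0 (u • one - m) fun γ hγ => by
        have := hgt' γ (C γ).toReal ENNReal.toReal_nonneg (ENNReal.ofReal_toReal hγ).ge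
        rw [← h0] at this
        simp only [map_sub, map_smul, BoundedContinuousFunction.sub_apply,
          BoundedContinuousFunction.smul_apply, hTone, smul_eq_mul]
        linarith
      simp only [map_sub, map_smul, hLone, smul_eq_mul] at this
      rw [← h0] at hlt
      linarith
    · have := hCV (lam⁻¹ • (u • one - m)) fun γ => by
        rcases eq_or_ne (C γ) ∞ with hγ | hγ
        · simp [hγ]
        have := hgt' γ (C γ).toReal ENNReal.toReal_nonneg (ENNReal.ofReal_toReal hγ).ge
        refine ENNReal.ofReal_le_of_le_toReal ?_
        simp only [map_sub, map_smul, BoundedContinuousFunction.sub_apply,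
          BoundedContinuousFunction.smul_apply, hTone, smul_eq_mul]
        rw [inv_mul_le_iff₀ hpos]
        linarith
      simp only [map_sub, map_smul, hLone, smul_eq_mul] at this
      rw [inv_mul_le_iff₀ hpos] at this
      linarith
  rw [Metric.mem_closure_iff] at hmem
  obtain ⟨v, ⟨hv0, μ, hμ, hμC⟩, hdist⟩ := hmem ε hε
  rw [Prod.dist_eq, max_lt_iff] at hdist
  refine ⟨μ, fun m hm => ?_, hμC.trans (ENNReal.ofReal_le_ofReal ?_)⟩
  · have := (dist_le_pi_dist (fun m : F => L m) v.1 ⟨m, hm⟩).trans hdist.1.le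
    rw [hμ ⟨m, hm⟩, ← Real.dist_eq, dist_comm]
    exact this
  · have := hdist.2
    rw [Real.dist_eq, abs_lt] at this
    linarith

/-- If the dual problem with constraint `T m ≤ C` and objective `L m` is bounded by `V`, then some
probability measure satisfies all the linear constraints `∫ T m = L m` and has cost at most `V`. -/
theorem exists_probabilityMeasure_of_dual_bound [MetrizableSpace Ω] [SeparableSpace Ω]
    (T : M →ₗ[ℝ] (Ω →ᵇ ℝ)) (L : M →ₗ[ℝ] ℝ) {one : M}
    (hTone : ∀ γ, T one γ = 1) (hLone : L one = 1) {C : Ω → ℝ≥0∞} (hC : LowerSemicontinuous C)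
    (hK : ∀ N : ℝ≥0, IsCompact {γ | C γ ≤ N}) {V : ℝ}
    (hCV : ∀ m, (∀ γ, ENNReal.ofReal (T m γ) ≤ C γ) → L m ≤ V)
    (hC0 : ∀ m, (∀ γ, C γ ≠ ∞ → T m γ ≤ 0) → L m ≤ 0) :
    ∃ μ : ProbabilityMeasure Ω, (∀ m, ∫ γ, T m γ ∂(μ : Measure Ω) = L m) ∧
      ∫⁻ γ, C γ ∂(μ : Measure Ω) ≤ ENNReal.ofReal V := by
  classical
  -- Finitely many constraints up to a tolerance: a directed family of nonempty compact sets, any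
  -- common point of which satisfies all constraints exactly.
  set D : Finset M × ℕ → Set (ProbabilityMeasure Ω) := fun p =>
    {μ | (∀ m ∈ p.1, |∫ γ, T m γ ∂(μ : Measure Ω) - L m| ≤ 1 / ((p.2 : ℝ) + 1)) ∧
      ∫⁻ γ, C γ ∂(μ : Measure Ω) ≤ ENNReal.ofReal (V + 1 / ((p.2 : ℝ) + 1))} with hD
  have hDne : ∀ p, (D p).Nonempty := fun p =>
    exists_probabilityMeasure_approx T L hTone hLone hC.measurable hCV hC0 p.1 (by positivity)
  have hDcl : ∀ p, IsClosed (D p) := fun p => by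
    have h1 : IsClosed {μ : ProbabilityMeasure Ω | ∀ m ∈ p.1,
        |∫ γ, T m γ ∂(μ : Measure Ω) - L m| ≤ 1 / ((p.2 : ℝ) + 1)} := by
      simp only [ofPred_forall]
      refine isClosed_biInter fun m _ => isClosed_le ?_ continuous_const
      have : Continuous fun μ : ProbabilityMeasure Ω => ∫ γ, T m γ ∂(μ : Measure Ω) :=
        continuous_iff_continuousAt.2 fun μ =>
          ProbabilityMeasure.tendsto_iff_forall_integral_tendsto.1 tendsto_id (T m)
      fun_prop
    exact h1.inter (isClosed_setOf_lintegral_le hC _)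
  have hDK : ∀ p, IsCompact (D p) := fun p =>
    (isCompact_setOf_lintegral_le hC hK (Real.toNNReal (V + 1 / ((p.2 : ℝ) + 1)))).of_isClosed_subset
      (hDcl p) fun μ hμ => hμ.2
  have hDanti : ∀ p q : Finset M × ℕ, p ≤ q → D q ⊆ D p := by
    intro p q hpq μ hμ
    have h1 : 1 / ((q.2 : ℝ) + 1) ≤ 1 / ((p.2 : ℝ) + 1) := by
      have : (p.2 : ℝ) ≤ q.2 := by exact_mod_cast hpq.2
      gcongr
    exact ⟨fun m hm => (hμ.1 m (hpq.1 hm)).trans h1,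
      hμ.2.trans (ENNReal.ofReal_le_ofReal (by linarith))⟩
  obtain ⟨μ, hμ⟩ := IsCompact.nonempty_iInter_of_directed_nonempty_isCompact_isClosed D
    (fun p q => ⟨p ⊔ q, hDanti _ _ le_sup_left, hDanti _ _ le_sup_right⟩) hDne hDK hDcl
  rw [mem_iInter] at hμ
  refine ⟨μ, fun m => ?_, ?_⟩
  · have h0 : ∀ n : ℕ, |∫ γ, T m γ ∂(μ : Measure Ω) - L m| ≤ 1 / ((n : ℝ) + 1) := fun n =>
      (hμ ({m}, n)).1 m (by simp)
    have := ge_of_tendsto' (tendsto_one_div_add_atTop_nhds_zero_nat (𝕜 := ℝ)) h0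
    exact sub_eq_zero.1 (abs_nonpos_iff.1 this)
  · have ht : Tendsto (fun i : ℕ => ENNReal.ofReal (V + 1 / ((i : ℝ) + 1))) atTop
        (𝓝 (ENNReal.ofReal V)) :=
      ENNReal.tendsto_ofReal (tendsto_const_add_one_div_nat V)
    exact ge_of_tendsto' ht fun n => (hμ (∅, n)).2

end Duality

/-! ### Kantorovich duality with endpoint constraints -/

section MarginalDuality

variable {Ω X : Type*} [TopologicalSpace Ω] [TopologicalSpace X] [CompactSpace X]

/-- The function `γ ↦ φ (e₀ γ) + ψ (e₁ γ)` as a linear function of `(φ, ψ)`. -/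
noncomputable def endpointSum (e₀ e₁ : C(Ω, X)) : C(X, ℝ) × C(X, ℝ) →ₗ[ℝ] (Ω →ᵇ ℝ) where
  toFun p := (mkOfCompact p.1).compContinuous e₀ + (mkOfCompact p.2).compContinuous e₁
  map_add' p q := by ext γ; simp; ring
  map_smul' a p := by ext γ; simp

@[simp] theorem endpointSum_apply (e₀ e₁ : C(Ω, X)) (p : C(X, ℝ) × C(X, ℝ)) (γ : Ω) :
    endpointSum e₀ e₁ p γ = p.1 (e₀ γ) + p.2 (e₁ γ) := rfl

variable [MeasurableSpace X] [BorelSpace X]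

theorem ContinuousMap.integrable_of_compactSpace (μ : Measure X) [IsFiniteMeasure μ] (φ : C(X, ℝ)) :
    Integrable φ μ :=
  (mkOfCompact φ).integrable μ

/-- The sum of the integrals of two continuous functions, as a linear functional. -/
noncomputable def integralSum (μ₀ μ₁ : Measure X) [IsFiniteMeasure μ₀] [IsFiniteMeasure μ₁] :
    C(X, ℝ) × C(X, ℝ) →ₗ[ℝ] ℝ where
  toFun p := ∫ x, p.1 x ∂μ₀ + ∫ y, p.2 y ∂μ₁
  map_add' p q := by
    simp only [Prod.fst_add, Prod.snd_add, ContinuousMap.add_apply]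
    rw [integral_add (p.1.integrable_of_compactSpace _) (q.1.integrable_of_compactSpace _),
      integral_add (p.2.integrable_of_compactSpace _) (q.2.integrable_of_compactSpace _)]
    ring
  map_smul' a p := by
    simp only [Prod.smul_fst, Prod.smul_snd, ContinuousMap.smul_apply, integral_smul,
      RingHom.id_apply, smul_add]

theorem integralSum_apply (μ₀ μ₁ : Measure X) [IsFiniteMeasure μ₀] [IsFiniteMeasure μ₁]
    (p : C(X, ℝ) × C(X, ℝ)) :
    integralSum μ₀ μ₁ p = ∫ x, p.1 x ∂μ₀ + ∫ y, p.2 y ∂μ₁ := rfl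

theorem integral_add_integral_le_of_forall_add_le {X Y : Type*} [MeasurableSpace X]
    [MeasurableSpace Y] {μ : Measure X} {ν : Measure Y} [IsProbabilityMeasure μ]
    [IsProbabilityMeasure ν] {φ f : X → ℝ} {ψ g : Y → ℝ} (hφ : Integrable φ μ)
    (hψ : Integrable ψ ν) (hf : Integrable f μ) (hg : Integrable g ν)
    (h : ∀ x y, φ x + ψ y ≤ f x + g y) :
    ∫ x, φ x ∂μ + ∫ y, ψ y ∂ν ≤ ∫ x, f x ∂μ + ∫ y, g y ∂ν := by
  have h1 : ∀ y, ∫ x, φ x ∂μ - ∫ x, f x ∂μ ≤ g y - ψ y := fun y => by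
    rw [← integral_sub hφ hf]
    have : ∫ x, (φ x - f x) ∂μ ≤ ∫ _, (g y - ψ y) ∂μ :=
      integral_mono (hφ.sub hf) (integrable_const _) fun x => by
        simp only; linarith [h x y]
    simpa using this
  have h2 : ∫ _, (∫ x, φ x ∂μ - ∫ x, f x ∂μ) ∂ν ≤ ∫ y, (g y - ψ y) ∂ν :=
    integral_mono (integrable_const _) (hg.sub hψ) h1
  rw [integral_sub hg hψ] at h2
  simp only [integral_const, probReal_univ, smul_eq_mul, one_mul] at h2
  linarith

/-- Two families whose pointwise sums are nonnegative become nonnegative after a shift by a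
constant. -/
theorem exists_shift_nonneg {X Y : Type*} [Nonempty X] [Nonempty Y] {a : X → ℝ} {b : Y → ℝ}
    (h : ∀ x y, 0 ≤ a x + b y) : ∃ α : ℝ, (∀ x, 0 ≤ a x - α) ∧ ∀ y, 0 ≤ b y + α := by
  obtain ⟨y₀⟩ := ‹Nonempty Y›
  have hb : BddBelow (range a) := ⟨-b y₀, by rintro _ ⟨x, rfl⟩; linarith [h x y₀]⟩
  refine ⟨⨅ x, a x, fun x => sub_nonneg.2 (ciInf_le hb x), fun y => ?_⟩
  have := le_ciInf fun x => show -b y ≤ a x by linarith [h x y]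
  linarith

theorem ofReal_add_half_le {a b : ℝ} {C : ℝ≥0∞} (ha : ENNReal.ofReal a ≤ C)
    (hb : ENNReal.ofReal b ≤ C) : ENNReal.ofReal ((a + b) / 2) ≤ C := by
  rcases le_total a b with h | h
  · exact (ENNReal.ofReal_le_ofReal (by linarith)).trans hb
  · exact (ENNReal.ofReal_le_ofReal (by linarith)).trans ha

variable (e₀ e₁ : C(Ω, X)) (μ₀ μ₁ : Measure X) [IsProbabilityMeasure μ₀] [IsProbabilityMeasure μ₁]

/-- Attainment in the dual problem: if the dual value is approached by continuous pairs, it is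
attained by a pair of integrable functions which satisfies the constraint off null sets. -/
theorem exists_integrable_dual_maximizer {C : Ω → ℝ≥0∞} {f g : X → ℝ} (hf : Integrable f μ₀)
    (hg : Integrable g μ₁)
    (hfg : ∀ p : C(X, ℝ) × C(X, ℝ), (∀ γ, ENNReal.ofReal (endpointSum e₀ e₁ p γ) ≤ C γ) →
      ∀ x y, p.1 x + p.2 y ≤ f x + g y) {V : ℝ}
    (hV : ∀ ε > 0, ∃ p : C(X, ℝ) × C(X, ℝ),
      (∀ γ, ENNReal.ofReal (endpointSum e₀ e₁ p γ) ≤ C γ) ∧ V - ε ≤ integralSum μ₀ μ₁ p) :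
    ∃ φ ψ : X → ℝ, Integrable φ μ₀ ∧ Integrable ψ μ₁ ∧
      (∃ A ∈ ae μ₀, ∃ B ∈ ae μ₁, ∀ γ, e₀ γ ∈ A → e₁ γ ∈ B →
        ENNReal.ofReal (φ (e₀ γ) + ψ (e₁ γ)) ≤ C γ) ∧
      V ≤ ∫ x, φ x ∂μ₀ + ∫ y, ψ y ∂μ₁ := by
  have hneX : Nonempty X := nonempty_of_isProbabilityMeasure μ₀
  have hinl : MeasurableEmbedding (Sum.inl : X → X ⊕ X) :=
    ⟨Sum.inl_injective, measurable_inl, fun _ hs => measurableSet_inl_image.2 hs⟩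
  have hinr : MeasurableEmbedding (Sum.inr : X → X ⊕ X) :=
    ⟨Sum.inr_injective, measurable_inr, fun _ hs => measurableSet_inr_image.2 hs⟩
  -- On the disjoint union the two slacks form one function, so a single selection makes both
  -- converge.
  set ν : Measure (X ⊕ X) := μ₀.map Sum.inl + μ₁.map Sum.inr with hν
  have : IsFiniteMeasure ν := by
    have h1 := Measure.isFiniteMeasure_map μ₀ (Sum.inl : X → X ⊕ X)
    have h2 := Measure.isFiniteMeasure_map μ₁ (Sum.inr : X → X ⊕ X)
    infer_instance
  have hlint : ∀ h : X ⊕ X → ℝ≥0∞, ∫⁻ z, h z ∂ν =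
      ∫⁻ x, h (Sum.inl x) ∂μ₀ + ∫⁻ y, h (Sum.inr y) ∂μ₁ := fun h => by
    rw [hν, lintegral_add_measure, hinl.lintegral_map,
      hinr.lintegral_map]
  have hae : ∀ P : X ⊕ X → Prop, (∀ᵐ z ∂ν, P z) ↔
      (∀ᵐ x ∂μ₀, P (Sum.inl x)) ∧ ∀ᵐ y ∂μ₁, P (Sum.inr y) := fun P => by
    rw [hν, ae_add_measure_iff, hinl.ae_map_iff,
      hinr.ae_map_iff]
  set K : ℝ := ∫ x, f x ∂μ₀ + ∫ y, g y ∂μ₁ with hKdef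
  set R : ℝ := K - V with hR
  -- Nonnegative slacks `s = (f - φ, g - ψ)` of feasible pairs whose dual value is within `1/(n+1)`
  -- of `V`.
  set S : ℕ → Set (X ⊕ X → ℝ) := fun n => {s | (∀ z, 0 ≤ s z) ∧
    Integrable (fun x => s (Sum.inl x)) μ₀ ∧ Integrable (fun y => s (Sum.inr y)) μ₁ ∧
    (∀ γ, ENNReal.ofReal ((f (e₀ γ) - s (Sum.inl (e₀ γ))) + (g (e₁ γ) - s (Sum.inr (e₁ γ)))) ≤ C γ) ∧
    ∫ x, s (Sum.inl x) ∂μ₀ + ∫ y, s (Sum.inr y) ∂μ₁ ≤ R + 1 / ((n : ℝ) + 1)} with hS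
  obtain ⟨s, a, hs, ham, hlim, ha0, hal⟩ := exists_ae_tendsto_of_midpoint (ν := ν) (R := R) (S := S)
    (by
      intro n m hnm s hs
      refine ⟨hs.1, hs.2.1, hs.2.2.1, hs.2.2.2.1, hs.2.2.2.2.trans ?_⟩
      have : (n : ℝ) ≤ m := by exact_mod_cast hnm
      gcongr)
    (by
      intro n
      obtain ⟨p, hp, hpV⟩ := hV (1 / ((n : ℝ) + 1)) (by positivity)
      have hp1 := p.1.integrable_of_compactSpace μ₀
      have hp2 := p.2.integrable_of_compactSpace μ₁
      -- Replacing `(φ, ψ)` by `(φ + α, ψ - α)` changes neither the constraint nor the dual value,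
      -- since both marginals have mass one.
      obtain ⟨α, hα0, hα1⟩ := exists_shift_nonneg (a := fun x => f x - p.1 x)
        (b := fun y => g y - p.2 y) fun x y => by linarith [hfg p hp x y]
      refine ⟨Sum.elim (fun x => f x - p.1 x - α) (fun y => g y - p.2 y + α), ?_, ?_, ?_, ?_, ?_⟩
      · rintro (x | y)
        exacts [hα0 x, hα1 y]
      · exact (hf.sub hp1).sub (integrable_const _)
      · exact (hg.sub hp2).add (integrable_const _)
      · intro γ
        have := hp γ
        simp only [Sum.elim_inl, Sum.elim_inr]
        convert this using 2
        simp only [endpointSum_apply]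
        ring
      · simp only [Sum.elim_inl, Sum.elim_inr]
        rw [integral_sub (f := fun x => f x - p.1 x) (hf.sub hp1) (integrable_const _),
          integral_add (f := fun y => g y - p.2 y) (hg.sub hp2) (integrable_const _), integral_sub hf hp1,
          integral_sub hg hp2]
        rw [integralSum_apply] at hpV
        simp only [integral_const, probReal_univ, smul_eq_mul, one_mul]
        linarith)
    (by
      intro n s hs
      have h1 : AEStronglyMeasurable s (μ₀.map Sum.inl) :=
        hinl.aestronglyMeasurable_map_iff.2 hs.2.1.1
      have h2 : AEStronglyMeasurable s (μ₁.map Sum.inr) :=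
        hinr.aestronglyMeasurable_map_iff.2 hs.2.2.1.1
      exact h1.add_measure h2)
    (fun n s hs => hs.1)
    (by
      intro n s hs t ht
      refine ⟨fun z => by linarith [hs.1 z, ht.1 z], (hs.2.1.add ht.2.1).div_const 2,
        (hs.2.2.1.add ht.2.2.1).div_const 2, fun γ => ?_, ?_⟩
      · have := ofReal_add_half_le (hs.2.2.2.1 γ) (ht.2.2.2.1 γ)
        convert this using 2
        ring
      · rw [integral_div, integral_div, integral_add hs.2.1 ht.2.1, integral_add hs.2.2.1 ht.2.2.1]
        linarith [hs.2.2.2.2, ht.2.2.2.2])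
    (by
      intro n s hs
      rw [hlint, ← ofReal_integral_eq_lintegral_ofReal hs.2.1 (Eventually.of_forall fun x => hs.1 _),
        ← ofReal_integral_eq_lintegral_ofReal hs.2.2.1 (Eventually.of_forall fun x => hs.1 _),
        ← ENNReal.ofReal_add (integral_nonneg fun x => hs.1 _) (integral_nonneg fun x => hs.1 _)]
      exact ENNReal.ofReal_le_ofReal hs.2.2.2.2)
  rw [hae] at hlim ha0
  rw [hlint] at hal
  have ham0 : AEStronglyMeasurable (fun x => a (Sum.inl x)) μ₀ :=
    hinl.aestronglyMeasurable_map_iff.1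
      (ham.mono_measure (Measure.le_add_right le_rfl))
  have ham1 : AEStronglyMeasurable (fun x => a (Sum.inr x)) μ₁ :=
    hinr.aestronglyMeasurable_map_iff.1
      (ham.mono_measure (Measure.le_add_left le_rfl))
  have hai0 : Integrable (fun x => a (Sum.inl x)) μ₀ := by
    refine ⟨ham0, (hasFiniteIntegral_iff_ofReal ha0.1).2 ?_⟩
    exact (le_self_add.trans hal).trans_lt ENNReal.ofReal_lt_top
  have hai1 : Integrable (fun x => a (Sum.inr x)) μ₁ := by
    refine ⟨ham1, (hasFiniteIntegral_iff_ofReal ha0.2).2 ?_⟩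
    exact (le_add_self.trans hal).trans_lt ENNReal.ofReal_lt_top
  have hR0 : 0 ≤ R := by
    have h0 : ∀ n : ℕ, 0 ≤ R + 1 / ((n : ℝ) + 1) := fun n =>
      (add_nonneg (integral_nonneg fun x => (hs n).1 _) (integral_nonneg fun x => (hs n).1 _)).trans
        (hs n).2.2.2.2
    exact ge_of_tendsto' (tendsto_const_add_one_div_nat R) h0
  refine ⟨fun x => f x - a (Sum.inl x), fun y => g y - a (Sum.inr y), hf.sub hai0, hg.sub hai1,
    ⟨_, hlim.1, _, hlim.2, fun γ h0 h1 => ?_⟩, ?_⟩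
  · have h0' : Tendsto (fun n => s n (Sum.inl (e₀ γ))) atTop (𝓝 (a (Sum.inl (e₀ γ)))) := h0
    have h1' : Tendsto (fun n => s n (Sum.inr (e₁ γ))) atTop (𝓝 (a (Sum.inr (e₁ γ)))) := h1
    refine le_of_tendsto' (ENNReal.tendsto_ofReal
      ((tendsto_const_nhds.sub h0').add (tendsto_const_nhds.sub h1'))) fun n => ?_
    exact (hs n).2.2.2.1 γ
  · rw [← ofReal_integral_eq_lintegral_ofReal hai0 ha0.1,
      ← ofReal_integral_eq_lintegral_ofReal hai1 ha0.2,
      ← ENNReal.ofReal_add (integral_nonneg_of_ae ha0.1) (integral_nonneg_of_ae ha0.2),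
      ENNReal.ofReal_le_ofReal_iff hR0] at hal
    rw [integral_sub hf hai0, integral_sub hg hai1]
    linarith

/-- Kantorovich duality for a coercive lower semicontinuous cost on a space with two endpoint maps:
the primal problem and, in the class of integrable functions, the dual problem have solutions, and
the dual value is approached by continuous functions. -/
theorem exists_kantorovich_duality [MeasurableSpace Ω] [BorelSpace Ω] [MetrizableSpace Ω]
    [SeparableSpace Ω] [HasOuterApproxClosed X] {C : Ω → ℝ≥0∞} (hC : LowerSemicontinuous C) (hK : ∀ N : ℝ≥0, IsCompact {γ | C γ ≤ N}) {f g : X → ℝ} (hf : Integrable f μ₀)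
    (hg : Integrable g μ₁) (hfg0 : ∀ x y, 0 ≤ f x + g y)
    (hfg : ∀ x y, ∀ r > f x + g y, ∃ γ, e₀ γ = x ∧ e₁ γ = y ∧ C γ ≤ ENNReal.ofReal r) :
    ∃ V : ℝ, 0 ≤ V ∧
      (∃ π : Measure Ω, IsProbabilityMeasure π ∧ π.map e₀ = μ₀ ∧ π.map e₁ = μ₁ ∧
        ∫⁻ γ, C γ ∂π ≤ ENNReal.ofReal V) ∧
      (∀ ε > 0, ∃ p : C(X, ℝ) × C(X, ℝ),
        (∀ γ, ENNReal.ofReal (endpointSum e₀ e₁ p γ) ≤ C γ) ∧ V - ε ≤ integralSum μ₀ μ₁ p) ∧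
      ∃ φ ψ : X → ℝ, Integrable φ μ₀ ∧ Integrable ψ μ₁ ∧
        (∃ A ∈ ae μ₀, ∃ B ∈ ae μ₁, ∀ γ, e₀ γ ∈ A → e₁ γ ∈ B →
          ENNReal.ofReal (φ (e₀ γ) + ψ (e₁ γ)) ≤ C γ) ∧
        V ≤ ∫ x, φ x ∂μ₀ + ∫ y, ψ y ∂μ₁ := by
  have hneX : Nonempty X := nonempty_of_isProbabilityMeasure μ₀
  set F : Set (C(X, ℝ) × C(X, ℝ)) :=
    {p | ∀ γ, ENNReal.ofReal (endpointSum e₀ e₁ p γ) ≤ C γ} with hF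
  have hbound : ∀ p ∈ F, ∀ x y, p.1 x + p.2 y ≤ f x + g y := by
    intro p hp x y
    refine le_of_forall_gt_imp_ge_of_dense fun r hr => ?_
    obtain ⟨γ, rfl, rfl, hγ⟩ := hfg x y r hr
    exact (ENNReal.ofReal_le_ofReal_iff ((hfg0 _ _).trans hr.le)).1 ((hp γ).trans hγ)
  have hbdd : BddAbove (integralSum μ₀ μ₁ '' F) := ⟨∫ x, f x ∂μ₀ + ∫ y, g y ∂μ₁, by
    rintro _ ⟨p, hp, rfl⟩
    exact integral_add_integral_le_of_forall_add_le (p.1.integrable_of_compactSpace _)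
      (p.2.integrable_of_compactSpace _) hf hg (hbound p hp)⟩
  have hne : (integralSum μ₀ μ₁ '' F).Nonempty := ⟨_, 0, fun γ => by simp, rfl⟩
  set V := sSup (integralSum μ₀ μ₁ '' F) with hVdef
  have happrox : ∀ ε > 0, ∃ p : C(X, ℝ) × C(X, ℝ),
        (∀ γ, ENNReal.ofReal (endpointSum e₀ e₁ p γ) ≤ C γ) ∧ V - ε ≤ integralSum μ₀ μ₁ p := by
    intro ε hε
    obtain ⟨_, ⟨p, hp, rfl⟩, h⟩ := exists_lt_of_lt_csSup hne (show V - ε < V by linarith)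
    exact ⟨p, hp, h.le⟩
  refine ⟨V, le_csSup hbdd ⟨0, fun γ => by simp, map_zero _⟩, ?_, happrox, exists_integrable_dual_maximizer e₀ e₁ μ₀ μ₁ hf hg hbound happrox⟩
  obtain ⟨π, hπ, hπC⟩ := exists_probabilityMeasure_of_dual_bound (endpointSum e₀ e₁)
    (integralSum μ₀ μ₁) (one := (1, 0)) (fun γ => by simp) (by simp [integralSum_apply]) hC hK
    (V := V) (fun p hp => le_csSup hbdd ⟨p, hp, rfl⟩) (by
      intro p hp
      -- Every pair of endpoints is joined by a path of finite cost, so a function nonpositive on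
      -- `{C < ∞}` gives `p.1 x + p.2 y ≤ 0` for all `x, y`.
      have := integral_add_integral_le_of_forall_add_le (μ := μ₀) (ν := μ₁)
        (p.1.integrable_of_compactSpace _) (p.2.integrable_of_compactSpace _)
        (integrable_zero _ _ _) (integrable_zero _ _ _) (fun x y => by
          obtain ⟨γ, rfl, rfl, hγ⟩ := hfg x y (f x + g y + 1) (by linarith)
          simpa using hp γ (ne_top_of_le_ne_top ENNReal.ofReal_ne_top hγ))
      simpa [integralSum_apply] using this)
  have hm0 : (π : Measure Ω).map e₀ = μ₀ := by
    have := Measure.isProbabilityMeasure_map (μ := (π : Measure Ω)) e₀.continuous.aemeasurable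
    refine ext_of_forall_integral_eq_of_IsFiniteMeasure fun φ => ?_
    rw [integral_map e₀.continuous.aemeasurable φ.continuous.aestronglyMeasurable]
    simpa [integralSum_apply] using hπ (φ.toContinuousMap, 0)
  have hm1 : (π : Measure Ω).map e₁ = μ₁ := by
    have := Measure.isProbabilityMeasure_map (μ := (π : Measure Ω)) e₁.continuous.aemeasurable
    refine ext_of_forall_integral_eq_of_IsFiniteMeasure fun φ => ?_
    rw [integral_map e₁.continuous.aemeasurable φ.continuous.aestronglyMeasurable]
    simpa [integralSum_apply] using hπ (0, φ.toContinuousMap)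
  exact ⟨π, inferInstance, hm0, hm1, hπC⟩

end MarginalDuality

/-! ### Positive semidefiniteness through feature maps -/

section FeatureMaps

variable {A Ω : Type*} [MeasurableSpace A] [MeasurableSpace Ω]

/-- Fubini, used twice, turns the bilinear form of the kernel into an average over `a` of products
of feature means. On the diagonal it is an average of squares. -/
theorem integral_integral_feature (P : Measure A) (μ ν : Measure Ω) [IsFiniteMeasure P]
    [IsFiniteMeasure μ] [IsFiniteMeasure ν] {u : A → Ω → ℝ}
    (hu : Measurable (Function.uncurry u)) (hb : ∀ a γ, |u a γ| ≤ 1) :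
    ∫ γ, ∫ σ, ∫ a, u a γ * u a σ ∂P ∂ν ∂μ =
      ∫ a, (∫ γ, u a γ ∂μ) * (∫ σ, u a σ ∂ν) ∂P := by
  have hua : ∀ a, Measurable (u a) := fun a => hu.comp measurable_prodMk_left
  have hug : ∀ γ, Measurable fun a => u a γ := fun γ => hu.comp measurable_prodMk_right
  have hw : StronglyMeasurable fun a => ∫ σ, u a σ ∂ν :=
    hu.stronglyMeasurable.integral_prod_right
  have hwb : ∀ a, |∫ σ, u a σ ∂ν| ≤ ν.real univ := fun a => by
    have := norm_integral_le_of_norm_le_const (μ := ν) (f := u a) (C := 1)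
      (Eventually.of_forall fun σ => hb a σ)
    simpa using this
  have h1 : ∀ γ, ∫ σ, ∫ a, u a γ * u a σ ∂P ∂ν = ∫ a, u a γ * ∫ σ, u a σ ∂ν ∂P := fun γ => by
    rw [integral_integral_swap]
    · simp_rw [integral_const_mul]
    · refine Integrable.of_bound (C := 1) ?_ (Eventually.of_forall fun p => ?_)
      · exact (((hug γ).comp measurable_snd).mul
          (hu.comp measurable_swap)).aestronglyMeasurable
      · simp only [Function.uncurry, Real.norm_eq_abs, abs_mul]
        exact mul_le_one₀ (hb _ _) (abs_nonneg _) (hb _ _)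
  simp_rw [h1]
  rw [integral_integral_swap]
  · simp_rw [integral_mul_const]
  · refine Integrable.of_bound (C := 1 * ν.real univ) ?_ (Eventually.of_forall fun p => ?_)
    · exact ((hu.comp measurable_swap).mul
        (hw.measurable.comp measurable_snd)).aestronglyMeasurable
    · simp only [Function.uncurry, Real.norm_eq_abs, abs_mul]
      exact mul_le_mul (hb _ _) (hwb _) (abs_nonneg _) zero_le_one

theorem integrable_integral_sq_feature (P : Measure A) (μ ν : Measure Ω) [IsFiniteMeasure P]
    [IsFiniteMeasure μ] [IsFiniteMeasure ν] {u : A → Ω → ℝ}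
    (hu : Measurable (Function.uncurry u)) (hb : ∀ a γ, |u a γ| ≤ 1) :
    Integrable (fun a => (∫ γ, u a γ ∂μ) * (∫ σ, u a σ ∂ν)) P := by
  have hw : ∀ (ρ : Measure Ω) [IsFiniteMeasure ρ], StronglyMeasurable fun a => ∫ σ, u a σ ∂ρ :=
    fun ρ _ => hu.stronglyMeasurable.integral_prod_right
  have hwb : ∀ (ρ : Measure Ω) [IsFiniteMeasure ρ], ∀ a, |∫ σ, u a σ ∂ρ| ≤ ρ.real univ :=
    fun ρ _ a => by
      have := norm_integral_le_of_norm_le_const (μ := ρ) (f := u a) (C := 1)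
        (Eventually.of_forall fun σ => hb a σ)
      simpa using this
  refine Integrable.of_bound (C := μ.real univ * ν.real univ)
    ((hw μ).mul (hw ν)).aestronglyMeasurable (Eventually.of_forall fun a => ?_)
  rw [Real.norm_eq_abs, abs_mul]
  exact mul_le_mul (hwb μ a) (hwb ν a) (abs_nonneg _) measureReal_nonneg

/-- A kernel which is an average of products of features is positive semidefinite. -/
theorem two_mul_integral_integral_feature_le (P : Measure A) (μ ν : Measure Ω) [IsFiniteMeasure P]
    [IsFiniteMeasure μ] [IsFiniteMeasure ν] {u : A → Ω → ℝ}
    (hu : Measurable (Function.uncurry u)) (hb : ∀ a γ, |u a γ| ≤ 1) :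
    2 * ∫ γ, ∫ σ, ∫ a, u a γ * u a σ ∂P ∂ν ∂μ ≤
      ∫ γ, ∫ σ, ∫ a, u a γ * u a σ ∂P ∂μ ∂μ + ∫ γ, ∫ σ, ∫ a, u a γ * u a σ ∂P ∂ν ∂ν := by
  simp_rw [integral_integral_feature P _ _ hu hb]
  rw [← integral_const_mul, ← integral_add (integrable_integral_sq_feature P μ μ hu hb)
    (integrable_integral_sq_feature P ν ν hu hb)]
  refine integral_mono ((integrable_integral_sq_feature P μ ν hu hb).const_mul 2)
    ((integrable_integral_sq_feature P μ μ hu hb).add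
      (integrable_integral_sq_feature P ν ν hu hb)) fun a => ?_
  simp only
  nlinarith [sq_nonneg (∫ γ, u a γ ∂μ - ∫ γ, u a γ ∂ν)]

end FeatureMaps

/-- The Gaussian as the Fourier transform of the standard Gaussian measure. -/
theorem exp_neg_mul_norm_sub_sq_eq_integral {E : Type*} [NormedAddCommGroup E]
    [InnerProductSpace ℝ E] [FiniteDimensional ℝ E] [MeasurableSpace E] [BorelSpace E]
    {β : ℝ} (hβ : 0 ≤ β) (x y : E) :
    Real.exp (-β * ‖x - y‖ ^ 2) =
      ∫ ξ, Real.cos (Real.sqrt (2 * β) * ⟪ξ, x⟫) * Real.cos (Real.sqrt (2 * β) * ⟪ξ, y⟫) +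
        Real.sin (Real.sqrt (2 * β) * ⟪ξ, x⟫) * Real.sin (Real.sqrt (2 * β) * ⟪ξ, y⟫)
          ∂(ProbabilityTheory.stdGaussian E) := by
  -- The factor `√(2β)` makes half the squared norm equal to `β ‖x - y‖²`. The real part of the
  -- characteristic function is then an average of cosines of differences, which the addition
  -- formula splits into features.
  have h := ProbabilityTheory.charFun_stdGaussian (E := E) (Real.sqrt (2 * β) • (x - y))
  have h1 : -((‖Real.sqrt (2 * β) • (x - y)‖ : ℂ)) ^ 2 / 2 = ((-β * ‖x - y‖ ^ 2 : ℝ) : ℂ) := by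
    rw [norm_smul, Real.norm_of_nonneg (Real.sqrt_nonneg _)]
    push_cast
    rw [mul_pow, ← Complex.ofReal_pow, Real.sq_sqrt (by positivity)]
    push_cast
    ring
  rw [h1, ← Complex.ofReal_exp, charFun_apply] at h
  have hre := congrArg Complex.re h
  rw [Complex.ofReal_re] at hre
  rw [← hre, ← RCLike.re_eq_complex_re, ← integral_re]
  · refine integral_congr_ae (Eventually.of_forall fun ξ => ?_)
    simp only [RCLike.re_eq_complex_re, Complex.exp_ofReal_mul_I_re]
    rw [inner_smul_right, inner_sub_right, mul_sub, Real.cos_sub]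
  · refine Integrable.of_bound (C := 1) (by fun_prop) (Eventually.of_forall fun ξ => ?_)
    rw [Complex.norm_exp_ofReal_mul_I]

namespace PathTransport

variable {n : ℕ} {X : Set (EuclideanSpace ℝ (Fin n))} {θ β : ℝ}

/-! ### Bounds and continuity of the kernel and the potential -/

section Kernel

theorem continuous_kernel_integrand :
    Continuous fun p : (PathSpace X × PathSpace X) × unitInterval =>
      θ * Real.exp (-β * ‖(p.1.1 p.2 : EuclideanSpace ℝ (Fin n)) - (p.1.2 p.2)‖ ^ 2) := by
  fun_prop

theorem kernel_integrand_nonneg (hθ : 0 ≤ θ) (r : ℝ) : 0 ≤ θ * Real.exp (-β * r ^ 2) := by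
  positivity

theorem kernel_integrand_le (hθ : 0 ≤ θ) (hβ : 0 ≤ β) (r : ℝ) :
    θ * Real.exp (-β * r ^ 2) ≤ θ :=
  mul_le_of_le_one_right hθ (Real.exp_le_one_iff.2 (by nlinarith [mul_nonneg hβ (sq_nonneg r)]))

theorem continuous_kernel (hθ : 0 ≤ θ) (hβ : 0 ≤ β) :
    Continuous fun p : PathSpace X × PathSpace X => kernel θ β p.1 p.2 := by
  refine continuous_of_dominated (bound := fun _ => θ) (fun p => ?_) (fun p => ?_)
    (integrable_const _) (Eventually.of_forall fun t => ?_)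
  · exact (continuous_kernel_integrand.comp (by fun_prop : Continuous fun t => (p, t))).aestronglyMeasurable
  · refine Eventually.of_forall fun t => ?_
    rw [Real.norm_of_nonneg (kernel_integrand_nonneg hθ _)]
    exact kernel_integrand_le hθ hβ _
  · fun_prop

theorem kernel_nonneg (hθ : 0 ≤ θ) (γ σ : PathSpace X) : 0 ≤ kernel θ β γ σ :=
  integral_nonneg fun _ => kernel_integrand_nonneg hθ _

theorem kernel_le (hθ : 0 ≤ θ) (hβ : 0 ≤ β) (γ σ : PathSpace X) : kernel θ β γ σ ≤ θ := by
  have h : Integrable (fun t : unitInterval => θ * Real.exp (-β *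
      ‖(γ t : EuclideanSpace ℝ (Fin n)) - (σ t : EuclideanSpace ℝ (Fin n))‖ ^ 2)) :=
    Integrable.of_bound (C := θ) (continuous_kernel_integrand.comp
      (by fun_prop : Continuous fun t => ((γ, σ), t))).aestronglyMeasurable
      (Eventually.of_forall fun t => by
        rw [Real.norm_of_nonneg (kernel_integrand_nonneg hθ _)]
        exact kernel_integrand_le hθ hβ _)
  have := integral_mono h (integrable_const θ) fun t => kernel_integrand_le hθ hβ _
  simpa [kernel] using this

theorem kernel_comm (γ σ : PathSpace X) : kernel θ β γ σ = kernel θ β σ γ := by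
  simp only [kernel, norm_sub_rev]

theorem integrable_kernel (hθ : 0 ≤ θ) (hβ : 0 ≤ β) (γ : PathSpace X) (π : Measure (PathSpace X))
    [IsFiniteMeasure π] : Integrable (fun σ => kernel θ β γ σ) π :=
  Integrable.of_bound (C := θ) ((continuous_kernel hθ hβ).comp
    (by fun_prop : Continuous fun σ => (γ, σ))).aestronglyMeasurable
    (Eventually.of_forall fun σ => by
      rw [Real.norm_of_nonneg (kernel_nonneg hθ _ _)]
      exact kernel_le hθ hβ _ _)

theorem potential_nonneg (hθ : 0 ≤ θ) (γ : PathSpace X) (π : Measure (PathSpace X)) :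
    0 ≤ potential θ β γ π :=
  integral_nonneg fun _ => kernel_nonneg hθ _ _

theorem potential_le (hθ : 0 ≤ θ) (hβ : 0 ≤ β) (γ : PathSpace X) (π : Measure (PathSpace X))
    [IsFiniteMeasure π] : potential θ β γ π ≤ π.real univ * θ := by
  refine (integral_mono (integrable_kernel hθ hβ γ π) (integrable_const θ) fun σ =>
    kernel_le hθ hβ γ σ).trans ?_
  simp

theorem continuous_potential (hθ : 0 ≤ θ) (hβ : 0 ≤ β) (π : Measure (PathSpace X))
    [IsFiniteMeasure π] : Continuous fun γ => potential θ β γ π := by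
  have hc : ∀ σ : PathSpace X, Continuous fun γ : PathSpace X => kernel θ β γ σ := fun σ =>
    (continuous_kernel hθ hβ).along_fst
  refine continuous_of_dominated (F := fun γ σ => kernel θ β γ σ) (bound := fun _ => θ)
    (fun γ => (integrable_kernel hθ hβ γ π).aestronglyMeasurable)
    (fun γ => Eventually.of_forall fun σ => ?_) (integrable_const _) (Eventually.of_forall hc)
  rw [Real.norm_of_nonneg (kernel_nonneg hθ _ _)]
  exact kernel_le hθ hβ _ _

theorem integrable_potential (hθ : 0 ≤ θ) (hβ : 0 ≤ β) (μ ν : Measure (PathSpace X))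
    [IsFiniteMeasure μ] [IsFiniteMeasure ν] : Integrable (fun γ => potential θ β γ ν) μ :=
  Integrable.of_bound (C := ν.real univ * θ) (continuous_potential hθ hβ ν).aestronglyMeasurable
    (Eventually.of_forall fun γ => by
      rw [Real.norm_of_nonneg (potential_nonneg hθ _ _)]
      exact potential_le hθ hβ _ _)

end Kernel

/-! ### The interaction energy as a positive semidefinite form -/

section Interaction

/-- The interaction energy `∫∫ K(γ,σ) dν(σ) dμ(γ)` of two measures on paths. -/
noncomputable def interaction (θ β : ℝ) (μ ν : Measure (PathSpace X)) : ℝ :=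
  ∫ γ, potential θ β γ ν ∂μ

theorem interaction_comm (hθ : 0 ≤ θ) (hβ : 0 ≤ β) (μ ν : Measure (PathSpace X))
    [IsFiniteMeasure μ] [IsFiniteMeasure ν] : interaction θ β μ ν = interaction θ β ν μ := by
  simp only [interaction, potential]
  rw [integral_integral_swap]
  · simp_rw [kernel_comm]
  · exact Integrable.of_bound (C := θ) (continuous_kernel hθ hβ).aestronglyMeasurable
      (Eventually.of_forall fun p => by
        simp only [Function.uncurry]
        rw [Real.norm_of_nonneg (kernel_nonneg hθ _ _)]
        exact kernel_le hθ hβ _ _)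

theorem interaction_combo_left (hθ : 0 ≤ θ) (hβ : 0 ≤ β) (μ ν ρ : Measure (PathSpace X))
    [IsFiniteMeasure μ] [IsFiniteMeasure ν] [IsFiniteMeasure ρ] (a b : ℝ≥0) :
    interaction θ β (a • μ + b • ν) ρ = a * interaction θ β μ ρ + b * interaction θ β ν ρ := by
  simp only [interaction]
  rw [integral_add_measure (integrable_potential hθ hβ _ _) (integrable_potential hθ hβ _ _),
    integral_smul_nnreal_measure, integral_smul_nnreal_measure]
  rfl

theorem interaction_combo_right (hθ : 0 ≤ θ) (hβ : 0 ≤ β) (ρ μ ν : Measure (PathSpace X))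
    [IsFiniteMeasure μ] [IsFiniteMeasure ν] [IsFiniteMeasure ρ] (a b : ℝ≥0) :
    interaction θ β ρ (a • μ + b • ν) = a * interaction θ β ρ μ + b * interaction θ β ρ ν := by
  rw [interaction_comm hθ hβ, interaction_combo_left hθ hβ, interaction_comm hθ hβ μ,
    interaction_comm hθ hβ ν]

theorem interaction_combo_self (hθ : 0 ≤ θ) (hβ : 0 ≤ β) (μ ν : Measure (PathSpace X))
    [IsFiniteMeasure μ] [IsFiniteMeasure ν] (a b : ℝ≥0) :
    interaction θ β (a • μ + b • ν) (a • μ + b • ν) =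
      a ^ 2 * interaction θ β μ μ + 2 * a * b * interaction θ β μ ν +
        b ^ 2 * interaction θ β ν ν := by
  rw [interaction_combo_left hθ hβ, interaction_combo_right hθ hβ, interaction_combo_right hθ hβ,
    interaction_comm hθ hβ ν μ]
  ring

theorem interaction_dirac_left (hθ : 0 ≤ θ) (hβ : 0 ≤ β) (γ : PathSpace X)
    (ν : Measure (PathSpace X)) [IsFiniteMeasure ν] :
    interaction θ β (Measure.dirac γ) ν = potential θ β γ ν :=
  integral_dirac' _ _ (continuous_potential hθ hβ ν).stronglyMeasurable

/-- The Gaussian interaction is positive semidefinite. -/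
theorem two_mul_interaction_le (hθ : 0 ≤ θ) (hβ : 0 ≤ β) (μ ν : Measure (PathSpace X))
    [IsFiniteMeasure μ] [IsFiniteMeasure ν] :
    2 * interaction θ β μ ν ≤ interaction θ β μ μ + interaction θ β ν ν := by
  set G := ProbabilityTheory.stdGaussian (EuclideanSpace ℝ (Fin n)) with hG
  set P : Measure (unitInterval × EuclideanSpace ℝ (Fin n)) := volume.prod G with hP
  set r := Real.sqrt (2 * β) with hr
  -- Features are indexed by a time and a Gaussian frequency: the cosine and the sine of the path's
  -- position at that time.
  set u : unitInterval × EuclideanSpace ℝ (Fin n) → PathSpace X → ℝ :=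
    fun a γ => Real.cos (r * ⟪a.2, (γ a.1 : EuclideanSpace ℝ (Fin n))⟫) with hu
  set v : unitInterval × EuclideanSpace ℝ (Fin n) → PathSpace X → ℝ :=
    fun a γ => Real.sin (r * ⟪a.2, (γ a.1 : EuclideanSpace ℝ (Fin n))⟫) with hv
  have huc : Continuous (Function.uncurry u) := by
    simp only [hu, Function.uncurry_def]; fun_prop
  have hvc : Continuous (Function.uncurry v) := by
    simp only [hv, Function.uncurry_def]; fun_prop
  have hub : ∀ a γ, |u a γ| ≤ 1 := fun a γ => Real.abs_cos_le_one _
  have hvb : ∀ a γ, |v a γ| ≤ 1 := fun a γ => Real.abs_sin_le_one _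
  have hprod : ∀ {w : unitInterval × EuclideanSpace ℝ (Fin n) → PathSpace X → ℝ},
      Continuous (Function.uncurry w) → (∀ a γ, |w a γ| ≤ 1) → ∀ γ σ,
        Integrable (fun a => w a γ * w a σ) P := fun {w} hw hwb γ σ => by
    refine Integrable.of_bound (C := 1) ?_ (Eventually.of_forall fun a => ?_)
    · exact ((hw.comp (by fun_prop : Continuous fun a => (a, γ))).mul
        (hw.comp (by fun_prop : Continuous fun a => (a, σ)))).aestronglyMeasurable
    · rw [Real.norm_eq_abs, abs_mul]
      exact mul_le_one₀ (hwb _ _) (abs_nonneg _) (hwb _ _)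
  have hker : ∀ γ σ : PathSpace X,
      kernel θ β γ σ = θ * (∫ a, u a γ * u a σ ∂P + ∫ a, v a γ * v a σ ∂P) := fun γ σ => by
    rw [← integral_add (hprod huc hub γ σ) (hprod hvc hvb γ σ), hP,
      integral_prod (fun a => u a γ * u a σ + v a γ * v a σ)
        ((hprod huc hub γ σ).add (hprod hvc hvb γ σ)), kernel, integral_const_mul]
    congr 1
    refine integral_congr_ae (Eventually.of_forall fun t => ?_)
    exact exp_neg_mul_norm_sub_sq_eq_integral hβ _ _
  have hker_int : ∀ {w : unitInterval × EuclideanSpace ℝ (Fin n) → PathSpace X → ℝ},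
      Continuous (Function.uncurry w) → (∀ a γ, |w a γ| ≤ 1) →
        Continuous fun p : PathSpace X × PathSpace X => ∫ a, w a p.1 * w a p.2 ∂P := by
    intro w hw hwb
    refine continuous_of_dominated (bound := fun _ => 1)
      (fun p => (hprod hw hwb _ _).aestronglyMeasurable)
      (fun p => Eventually.of_forall fun a => ?_) (integrable_const _)
      (Eventually.of_forall fun a => ?_)
    · rw [Real.norm_eq_abs, abs_mul]
      exact mul_le_one₀ (hwb _ _) (abs_nonneg _) (hwb _ _)
    · exact (hw.comp (by fun_prop : Continuous fun p : PathSpace X × PathSpace X => (a, p.1))).mul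
        (hw.comp (by fun_prop : Continuous fun p : PathSpace X × PathSpace X => (a, p.2)))
  have hbd : ∀ {w : unitInterval × EuclideanSpace ℝ (Fin n) → PathSpace X → ℝ},
      (∀ a γ, |w a γ| ≤ 1) → ∀ γ σ, ‖∫ a, w a γ * w a σ ∂P‖ ≤ 1 := by
    intro w hwb γ σ
    have := norm_integral_le_of_norm_le_const (μ := P) (f := fun a => w a γ * w a σ) (C := 1)
      (Eventually.of_forall fun a => by
        rw [Real.norm_eq_abs, abs_mul]
        exact mul_le_one₀ (hwb _ _) (abs_nonneg _) (hwb _ _))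
    simpa using this
  have hinner : ∀ {w : unitInterval × EuclideanSpace ℝ (Fin n) → PathSpace X → ℝ},
      Continuous (Function.uncurry w) → (∀ a γ, |w a γ| ≤ 1) →
        ∀ (ρ τ : Measure (PathSpace X)) [IsFiniteMeasure ρ] [IsFiniteMeasure τ],
        (∀ γ, Integrable (fun σ => ∫ a, w a γ * w a σ ∂P) ρ) ∧
          Integrable (fun γ => ∫ σ, ∫ a, w a γ * w a σ ∂P ∂ρ) τ := by
    intro w hw hwb ρ τ _ _
    have hI : Integrable (fun p : PathSpace X × PathSpace X => ∫ a, w a p.1 * w a p.2 ∂P)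
        (τ.prod ρ) :=
      Integrable.of_bound (hker_int hw hwb).aestronglyMeasurable 1
        (Eventually.of_forall fun p => hbd hwb _ _)
    refine ⟨fun γ => ?_, hI.integral_prod_left⟩
    exact Integrable.of_bound ((hker_int hw hwb).comp
      (by fun_prop : Continuous fun σ => (γ, σ))).aestronglyMeasurable 1
        (Eventually.of_forall fun σ => hbd hwb _ _)
  have hint : ∀ (ρ τ : Measure (PathSpace X)) [IsFiniteMeasure ρ] [IsFiniteMeasure τ],
      interaction θ β ρ τ = θ * (∫ γ, ∫ σ, ∫ a, u a γ * u a σ ∂P ∂τ ∂ρ +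
        ∫ γ, ∫ σ, ∫ a, v a γ * v a σ ∂P ∂τ ∂ρ) := by
    intro ρ τ _ _
    simp only [interaction, potential, hker]
    rw [← integral_add (hinner huc hub τ ρ).2 (hinner hvc hvb τ ρ).2, ← integral_const_mul]
    refine integral_congr_ae (Eventually.of_forall fun γ => ?_)
    simp only
    rw [integral_const_mul, integral_add ((hinner huc hub τ ρ).1 γ) ((hinner hvc hvb τ ρ).1 γ)]
  rw [hint μ ν, hint μ μ, hint ν ν]
  have h1 := two_mul_integral_integral_feature_le P μ ν huc.measurable hub
  have h2 := two_mul_integral_integral_feature_le P μ ν hvc.measurable hvb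
  nlinarith [mul_le_mul_of_nonneg_left (add_le_add h1 h2) hθ]

end Interaction

end PathTransport

/-- The first-order condition at an endpoint of a quadratic polynomial. -/
theorem nonneg_of_forall_mul_add_sq_mul_nonneg {d r : ℝ}
    (h : ∀ t : ℝ, 0 < t → t < 1 → 0 ≤ t * d + t ^ 2 * r) : 0 ≤ d := by
  have hlim : Tendsto (fun t : ℝ => d + t * r) (𝓝[>] 0) (𝓝 d) := by
    have : Continuous fun t : ℝ => d + t * r := by fun_prop
    simpa using (this.tendsto 0).mono_left nhdsWithin_le_nhds
  refine ge_of_tendsto hlim ?_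
  filter_upwards [Ioo_mem_nhdsGT (zero_lt_one' ℝ)] with t ht
  have h1 := h t ht.1 ht.2
  have h2 : t * d + t ^ 2 * r = t * (d + t * r) := by ring
  rw [h2] at h1
  exact nonneg_of_mul_nonneg_right h1 ht.1

namespace PathTransport

variable {n : ℕ} {X : Set (EuclideanSpace ℝ (Fin n))} {c : PathSpace X → EReal} {m θ β : ℝ}

/-! ### Passing from extended-real costs to nonnegative ones -/

section ShiftedCost

/-- The cost made nonnegative by subtracting a lower bound `m`. -/
noncomputable def shiftedCost (c : PathSpace X → EReal) (m : ℝ) (γ : PathSpace X) : ℝ≥0∞ :=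
  (c γ - (m : EReal)).toENNReal

theorem shiftedCost_of_eq_coe {γ : PathSpace X} {x : ℝ} (h : c γ = x) :
    shiftedCost c m γ = ENNReal.ofReal (x - m) := by
  rw [shiftedCost, h, ← EReal.coe_sub, EReal.real_coe_toENNReal]

theorem shiftedCost_of_eq_top {γ : PathSpace X} (h : c γ = ⊤) : shiftedCost c m γ = ∞ := by
  rw [shiftedCost, h, EReal.top_sub_coe, EReal.toENNReal_top]

theorem eq_top_or_exists_coe (hm : ∀ γ, (m : EReal) ≤ c γ) (γ : PathSpace X) :
    c γ = ⊤ ∨ ∃ x : ℝ, m ≤ x ∧ c γ = x := by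
  rcases eq_or_ne (c γ) ⊤ with h | h
  · exact Or.inl h
  · have hb : c γ ≠ ⊥ := ((EReal.bot_lt_coe m).trans_le (hm γ)).ne'
    refine Or.inr ⟨(c γ).toReal, ?_, (EReal.coe_toReal h hb).symm⟩
    rw [← EReal.coe_le_coe_iff, EReal.coe_toReal h hb]
    exact hm γ

theorem lowerSemicontinuous_shiftedCost (hc : LowerSemicontinuous c) (m : ℝ) :
    LowerSemicontinuous (shiftedCost c m) := by
  have hcont : Continuous fun y : EReal => (y - (m : EReal)).toENNReal := by
    refine EReal.continuous_toENNReal.comp (continuous_iff_continuousAt.2 fun y => ?_)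
    have h := EReal.continuousAt_add (p := (y, -(m : EReal)))
      (Or.inr (by rw [← EReal.coe_neg]; exact EReal.coe_ne_bot _))
      (Or.inr (by rw [← EReal.coe_neg]; exact EReal.coe_ne_top _))
    exact h.comp (f := fun y : EReal => (y, -(m : EReal)))
      (continuousAt_id.prodMk continuousAt_const)
  exact hcont.comp_lowerSemicontinuous hc fun x y hxy =>
    EReal.toENNReal_le_toENNReal (EReal.sub_le_sub hxy le_rfl)

/-- The identity `(c - m) + c⁻ + m⁺ = c⁺ + m⁻` holds pointwise without subtracting infinities. It is
integrated in `[0, ∞]`, and then `∫ c⁻` is moved across, being finite because `c ≥ m` and `π` is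
finite. -/
theorem costIntegral_eq (hc : Measurable c) (hm : ∀ γ, (m : EReal) ≤ c γ)
    (π : Measure (PathSpace X)) [IsFiniteMeasure π] :
    costIntegral c π =
      ((∫⁻ γ, shiftedCost c m γ ∂π : ℝ≥0∞) : EReal) + ((m * π.real univ : ℝ) : EReal) := by
  have hpt : ∀ γ, shiftedCost c m γ + ((-c γ).toENNReal + ENNReal.ofReal m) =
      (c γ).toENNReal + ENNReal.ofReal (-m) := by
    intro γ
    rcases eq_top_or_exists_coe hm γ with h | ⟨x, hx, h⟩
    · rw [shiftedCost_of_eq_top h, h]; simp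
    · rw [shiftedCost_of_eq_coe h, h, ← EReal.coe_neg, EReal.real_coe_toENNReal,
        EReal.real_coe_toENNReal]
      rw [← ENNReal.toReal_eq_toReal_iff' (by finiteness) (by finiteness),
        ENNReal.toReal_add (by finiteness) (by finiteness),
        ENNReal.toReal_add (by finiteness) (by finiteness),
        ENNReal.toReal_add (by finiteness) (by finiteness)]
      simp only [ENNReal.toReal_ofReal']
      rw [max_eq_left (by linarith : (0 : ℝ) ≤ x - m)]
      rcases le_total 0 x with h1 | h1 <;> rcases le_total 0 m with h2 | h2 <;>
        simp [h1, h2] <;> ring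
  have hnegm : Measurable fun γ => (-c γ).toENNReal :=
    measurable_ereal_toENNReal.comp hc.neg
  have hint := lintegral_congr (μ := π) hpt
  rw [lintegral_add_right _ (hnegm.add_const _), lintegral_add_right _ measurable_const,
    lintegral_add_right _ measurable_const, lintegral_const, lintegral_const] at hint
  have hnegf : ∫⁻ γ, (-c γ).toENNReal ∂π ≠ ∞ := by
    refine ne_top_of_le_ne_top (b := ∫⁻ _, ENNReal.ofReal (-m) ∂π) ?_ (lintegral_mono fun γ => ?_)
    · rw [lintegral_const]; finiteness
    · rw [← EReal.real_coe_toENNReal, EReal.coe_neg]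
      exact EReal.toENNReal_le_toENNReal (EReal.neg_le_neg_iff.2 (hm γ))
  rw [costIntegral]
  generalize ∫⁻ γ, shiftedCost c m γ ∂π = S at hint ⊢
  generalize ∫⁻ γ, (-c γ).toENNReal ∂π = N at hint hnegf ⊢
  generalize ∫⁻ γ, (c γ).toENNReal ∂π = P at hint ⊢
  lift N to ℝ≥0 using hnegf
  have hmu : π univ = ENNReal.ofReal (π.real univ) := by simp
  rw [hmu, ← ENNReal.ofReal_mul' measureReal_nonneg, ← ENNReal.ofReal_mul' measureReal_nonneg] at hint
  rcases eq_or_ne S ∞ with hS | hS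
  · have hP : P = ∞ := by
      rw [hS, top_add] at hint
      exact (ENNReal.add_eq_top.1 hint.symm).resolve_right ENNReal.ofReal_ne_top
    rw [hS, hP, EReal.coe_ennreal_top, EReal.top_add_coe]
    exact EReal.top_sub_coe (N : ℝ)
  · have hP : P ≠ ∞ := by
      intro hP
      rw [hP, top_add] at hint
      have h : S + ((N : ℝ≥0∞) + ENNReal.ofReal (m * π.real univ)) ≠ ∞ := by finiteness
      exact h hint
    lift S to ℝ≥0 using hS
    lift P to ℝ≥0 using hP
    have hr := congrArg ENNReal.toReal hint
    rw [ENNReal.toReal_add (by finiteness) (by finiteness),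
        ENNReal.toReal_add (by finiteness) (by finiteness),
        ENNReal.toReal_add (by finiteness) (by finiteness)] at hr
    simp only [ENNReal.toReal_ofReal', ENNReal.coe_toReal] at hr
    have hmm : max (m * π.real univ) 0 - max (-m * π.real univ) 0 = m * π.real univ := by
      rw [neg_mul]
      exact max_zero_sub_max_neg_zero_eq_self _
    change ((P : ℝ) : EReal) - ((N : ℝ) : EReal) = ((S : ℝ) : EReal) + _
    rw [← EReal.coe_sub, ← EReal.coe_add]
    congr 1
    linarith

/-- If `r - m` is negative, `ENNReal.ofReal` truncates it to zero. This loses nothing, because `c -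
m + u` is nonnegative. -/
theorem coe_le_add_iff (hm : ∀ γ, (m : EReal) ≤ c γ) (γ : PathSpace X) {u : ℝ} (hu : 0 ≤ u)
    (r : ℝ) : (r : EReal) ≤ c γ + (u : EReal) ↔
      ENNReal.ofReal (r - m) ≤ shiftedCost c m γ + ENNReal.ofReal u := by
  rcases eq_top_or_exists_coe hm γ with h | ⟨x, hx, h⟩
  · rw [shiftedCost_of_eq_top h, h]; simp
  · rw [shiftedCost_of_eq_coe h, h, ← ENNReal.ofReal_add (by linarith) hu,
      ENNReal.ofReal_le_ofReal_iff (by linarith), ← EReal.coe_add, EReal.coe_le_coe_iff]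
    constructor <;> intro <;> linarith

theorem coe_eq_add_iff (hm : ∀ γ, (m : EReal) ≤ c γ) {γ : PathSpace X}
    (hγ : shiftedCost c m γ ≠ ∞) (u r : ℝ) : (r : EReal) = c γ + (u : EReal) ↔
      r = (shiftedCost c m γ).toReal + m + u := by
  rcases eq_top_or_exists_coe hm γ with h | ⟨x, hx, h⟩
  · exact absurd (shiftedCost_of_eq_top h) hγ
  · rw [shiftedCost_of_eq_coe h, h, ENNReal.toReal_ofReal (by linarith), ← EReal.coe_add,
      EReal.coe_eq_coe_iff]
    constructor <;> intro h <;> linarith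

theorem le_toReal_of_coe_le (hm : ∀ γ, (m : EReal) ≤ c γ) {γ : PathSpace X}
    (hγ : shiftedCost c m γ ≠ ∞) {u r : ℝ} (h : (r : EReal) ≤ c γ + (u : EReal)) :
    r ≤ (shiftedCost c m γ).toReal + m + u := by
  rcases eq_top_or_exists_coe hm γ with h' | ⟨x, hx, h'⟩
  · exact absurd (shiftedCost_of_eq_top h') hγ
  · rw [h', ← EReal.coe_add, EReal.coe_le_coe_iff] at h
    rw [shiftedCost_of_eq_coe h', ENNReal.toReal_ofReal (by linarith)]
    linarith

/-- Since `X` is bounded, the condition on `γ 0` in the coercivity hypothesis is void for large `M`.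
Taking maxima with `1` meets its positivity requirements. -/
theorem isCompact_shiftedCost_add_le (hX : IsCompact X) (hc : IsCoerciveCost c)
    (hm : ∀ γ, (m : EReal) ≤ c γ) {u : PathSpace X → ℝ≥0∞} (hu : LowerSemicontinuous u)
    (N : ℝ≥0) : IsCompact {γ | shiftedCost c m γ + u γ ≤ N} := by
  obtain ⟨M, hM⟩ := hX.isBounded.exists_norm_le
  refine (hc.isCompact_sublevel (max M 1) (max (N + m) 1) (by positivity)
    (by positivity)).of_isClosed_subset
    (((lowerSemicontinuous_shiftedCost hc.lowerSemicontinuous m).add hu).isClosed_preimage _)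
    fun γ hγ => ⟨(hM _ (γ 0).2).trans (le_max_left _ _), ?_⟩
  have hγ' : shiftedCost c m γ ≤ N :=
    le_self_add.trans (show shiftedCost c m γ + u γ ≤ N from hγ)
  rcases eq_top_or_exists_coe hm γ with h | ⟨x, hx, h⟩
  · rw [shiftedCost_of_eq_top h] at hγ'
    exact absurd (top_le_iff.1 hγ') ENNReal.coe_ne_top
  · rw [shiftedCost_of_eq_coe h, ENNReal.ofReal_le_iff_le_toReal ENNReal.coe_ne_top,
      ENNReal.coe_toReal] at hγ'
    rw [h, EReal.coe_le_coe_iff]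
    exact (by linarith : x ≤ N + m).trans (le_max_left _ _)

theorem lintegral_shiftedCost_combo (μ ν : Measure (PathSpace X)) (a b : ℝ≥0) :
    ∫⁻ γ, shiftedCost c m γ ∂(a • μ + b • ν) =
      a * ∫⁻ γ, shiftedCost c m γ ∂μ + b * ∫⁻ γ, shiftedCost c m γ ∂ν := by
  rw [lintegral_add_measure, lintegral_smul_measure, lintegral_smul_measure]
  rfl

theorem toReal_lintegral_shiftedCost_combo {μ ν : Measure (PathSpace X)}
    (hμ : ∫⁻ γ, shiftedCost c m γ ∂μ ≠ ∞) (hν : ∫⁻ γ, shiftedCost c m γ ∂ν ≠ ∞) (a b : ℝ≥0) :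
    ∫⁻ γ, shiftedCost c m γ ∂(a • μ + b • ν) ≠ ∞ ∧
    (∫⁻ γ, shiftedCost c m γ ∂(a • μ + b • ν)).toReal =
      a * (∫⁻ γ, shiftedCost c m γ ∂μ).toReal + b * (∫⁻ γ, shiftedCost c m γ ∂ν).toReal := by
  rw [lintegral_shiftedCost_combo]
  refine ⟨by finiteness, ?_⟩
  rw [ENNReal.toReal_add (by finiteness) (by finiteness), ENNReal.toReal_mul, ENNReal.toReal_mul,
    ENNReal.coe_toReal, ENNReal.coe_toReal]

theorem interactionFunctional_eq (hc : Measurable c) (hm : ∀ γ, (m : EReal) ≤ c γ)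
    (π : Measure (PathSpace X)) [IsFiniteMeasure π] :
    interactionFunctional c θ β π = ((∫⁻ γ, shiftedCost c m γ ∂π : ℝ≥0∞) : EReal) +
      ((m * π.real univ + interaction θ β π π : ℝ) : EReal) := by
  rw [interactionFunctional, costIntegral_eq hc hm, add_assoc, EReal.coe_add]
  rfl

theorem energy_eq (hc : Measurable c) (hm : ∀ γ, (m : EReal) ≤ c γ)
    (π : Measure (PathSpace X)) [IsFiniteMeasure π] :
    energy c θ β π = ((∫⁻ γ, shiftedCost c m γ ∂π : ℝ≥0∞) : EReal) +
      ((m * π.real univ + 2 * interaction θ β π π : ℝ) : EReal) := by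
  rw [energy, costIntegral_eq hc hm, add_assoc, EReal.coe_add, integral_const_mul]
  rfl

theorem coe_ennreal_eq_coe_toReal {a : ℝ≥0∞} (ha : a ≠ ∞) : (a : EReal) = (a.toReal : EReal) := by
  lift a to ℝ≥0 using ha
  rfl

end ShiftedCost

/-! ### Linearization at the minimizer -/

variable {μ₀ μ₁ : Measure X} {π₀ : Measure (PathSpace X)}

theorem measurable_path_eval (t : unitInterval) : Measurable fun γ : PathSpace X => γ t :=
  (by fun_prop : Continuous fun γ : PathSpace X => γ t).measurable

theorem IsAdmissiblePlan.combo {π ρ : Measure (PathSpace X)} (hπ : IsAdmissiblePlan μ₀ μ₁ π)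
    (hρ : IsAdmissiblePlan μ₀ μ₁ ρ) {a b : ℝ≥0} (hab : a + b = 1) :
    IsAdmissiblePlan μ₀ μ₁ (a • π + b • ρ) := by
  have := hπ.1
  have := hρ.1
  have h0 := measurable_path_eval (X := X) 0
  have h1 := measurable_path_eval (X := X) 1
  refine ⟨⟨?_⟩, ?_, ?_⟩
  · simp only [Measure.add_apply, Measure.smul_apply, measure_univ, ENNReal.smul_def, smul_eq_mul,
      mul_one]
    exact_mod_cast hab
  · rw [Measure.map_add _ _ h0, Measure.map_smul, Measure.map_smul, hπ.2.1, hρ.2.1, ← add_smul,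
      hab, one_smul]
  · rw [Measure.map_add _ _ h1, Measure.map_smul, Measure.map_smul, hπ.2.2, hρ.2.2, ← add_smul,
      hab, one_smul]

/-- A solution of the interaction problem solves the linear problem with cost
`c + 2 U(·; π₀)`. -/
theorem SolvesPrimal.linearized (hθ : 0 ≤ θ) (hβ : 0 ≤ β) (hc : Measurable c)
    (hm : ∀ γ, (m : EReal) ≤ c γ) (h : SolvesPrimal c θ β μ₀ μ₁ π₀) {π : Measure (PathSpace X)}
    (hπ : IsAdmissiblePlan μ₀ μ₁ π) (hfin : ∫⁻ γ, shiftedCost c m γ ∂π ≠ ∞) :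
    ∫⁻ γ, shiftedCost c m γ ∂π₀ ≠ ∞ ∧
      (∫⁻ γ, shiftedCost c m γ ∂π₀).toReal + 2 * interaction θ β π₀ π₀ ≤
        (∫⁻ γ, shiftedCost c m γ ∂π).toReal + 2 * interaction θ β π π₀ := by
  have := h.1.1
  have := hπ.1
  have hfin₀ : ∫⁻ γ, shiftedCost c m γ ∂π₀ ≠ ∞ := by
    intro htop
    have hle := h.2 π hπ
    rw [interactionFunctional_eq hc hm, interactionFunctional_eq hc hm, htop,
      EReal.coe_ennreal_top, EReal.top_add_coe, coe_ennreal_eq_coe_toReal hfin,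
      ← EReal.coe_add] at hle
    exact EReal.coe_ne_top _ (top_le_iff.1 hle)
  refine ⟨hfin₀, ?_⟩
  rw [← sub_nonneg]
  -- `r` is the coefficient of `t²` in the functional along `(1 - t) π₀ + t π`. The coefficient of
  -- `t` is the difference of the linearized costs.
  refine nonneg_of_forall_mul_add_sq_mul_nonneg (r := interaction θ β π₀ π₀ -
    2 * interaction θ β π π₀ + interaction θ β π π) fun t ht0 ht1 => ?_
  lift t to ℝ≥0 using ht0.le
  have ht1' : t ≤ 1 := by exact_mod_cast ht1.le
  have hab : (1 - t) + t = 1 := tsub_add_cancel_of_le ht1'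
  have hle := h.2 _ (h.1.combo hπ hab)
  have := (h.1.combo hπ hab).1
  obtain ⟨hf, hr⟩ := toReal_lintegral_shiftedCost_combo (m := m) hfin₀ hfin (1 - t) t
  rw [interactionFunctional_eq hc hm, interactionFunctional_eq hc hm,
    coe_ennreal_eq_coe_toReal hfin₀, coe_ennreal_eq_coe_toReal hf, ← EReal.coe_add,
    ← EReal.coe_add, EReal.coe_le_coe_iff, hr, interaction_combo_self hθ hβ,
    interaction_comm hθ hβ π₀ π] at hle
  simp only [probReal_univ, NNReal.coe_sub ht1', NNReal.coe_one] at hle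
  linarith

theorem lintegral_shiftedCost_add_potential (hθ : 0 ≤ θ) (hβ : 0 ≤ β) (π ρ : Measure (PathSpace X))
    [IsFiniteMeasure π] [IsFiniteMeasure ρ] :
    ∫⁻ γ, (shiftedCost c m γ + ENNReal.ofReal (2 * potential θ β γ ρ)) ∂π =
      ∫⁻ γ, shiftedCost c m γ ∂π + ENNReal.ofReal (2 * interaction θ β π ρ) := by
  rw [lintegral_add_right _ ((continuous_potential hθ hβ ρ).measurable.const_mul 2).ennreal_ofReal,
    interaction, ← integral_const_mul,
    ofReal_integral_eq_lintegral_ofReal ((integrable_potential hθ hβ π ρ).const_mul 2)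
      (Eventually.of_forall fun γ => mul_nonneg zero_le_two (potential_nonneg hθ _ _))]

theorem integral_toReal_shiftedCost_add_potential (hθ : 0 ≤ θ) (hβ : 0 ≤ β) (hc : Measurable c)
    (π ρ : Measure (PathSpace X)) [IsFiniteMeasure π] [IsFiniteMeasure ρ]
    (hfin : ∫⁻ γ, shiftedCost c m γ ∂π ≠ ∞) :
    Integrable (fun γ => (shiftedCost c m γ).toReal + m + 2 * potential θ β γ ρ) π ∧
      ∫ γ, ((shiftedCost c m γ).toReal + m + 2 * potential θ β γ ρ) ∂π =
        (∫⁻ γ, shiftedCost c m γ ∂π).toReal + m * π.real univ + 2 * interaction θ β π ρ := by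
  have hsm : Measurable (shiftedCost c m) := measurable_ereal_toENNReal.comp (hc.sub_const _)
  have h1 : Integrable (fun γ => (shiftedCost c m γ).toReal) π :=
    integrable_toReal_of_lintegral_ne_top hsm.aemeasurable hfin
  have h2 := (integrable_potential hθ hβ π ρ).const_mul 2
  have h3 : Integrable (fun γ => (shiftedCost c m γ).toReal + m) π := h1.add (integrable_const m)
  refine ⟨h3.add h2, ?_⟩
  rw [integral_add h3 h2, integral_add h1 (integrable_const m),
    integral_toReal hsm.aemeasurable (ae_lt_top hsm hfin), integral_const, integral_const_mul,
    interaction, smul_eq_mul, mul_comm m]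

/-! ### Weak and strong duality for the linearized problem -/

section Marginals

theorem IsAdmissiblePlan.integrable_endpoints {π : Measure (PathSpace X)}
    (hπ : IsAdmissiblePlan μ₀ μ₁ π) {φ ψ : X → ℝ} (hφ : Integrable φ μ₀) (hψ : Integrable ψ μ₁) :
    Integrable (fun γ => φ (γ 0) + ψ (γ 1)) π ∧
      ∫ γ, (φ (γ 0) + ψ (γ 1)) ∂π = dualValue μ₀ μ₁ φ ψ := by
  have h0 := measurable_path_eval (X := X) 0
  have h1 := measurable_path_eval (X := X) 1
  rw [← hπ.2.1] at hφ
  rw [← hπ.2.2] at hψ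
  have i0 : Integrable (fun γ => φ (γ 0)) π := hφ.comp_measurable h0
  have i1 : Integrable (fun γ => ψ (γ 1)) π := hψ.comp_measurable h1
  refine ⟨i0.add i1, ?_⟩
  rw [integral_add i0 i1, dualValue, ← integral_map h0.aemeasurable (by
    exact hφ.aestronglyMeasurable), ← integral_map h1.aemeasurable (by
    exact hψ.aestronglyMeasurable), hπ.2.1, hπ.2.2]

theorem IsAdmissiblePlan.ae_of_mem_ae {π : Measure (PathSpace X)}
    (hπ : IsAdmissiblePlan μ₀ μ₁ π) {A B : Set X} (hA : A ∈ ae μ₀) (hB : B ∈ ae μ₁) :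
    ∀ᵐ γ ∂π, γ 0 ∈ A ∧ γ 1 ∈ B := by
  have h0 := measurable_path_eval (X := X) 0
  have h1 := measurable_path_eval (X := X) 1
  rw [← hπ.2.1] at hA
  rw [← hπ.2.2] at hB
  exact (ae_of_ae_map h0.aemeasurable hA).and (ae_of_ae_map h1.aemeasurable hB)

end Marginals

/-- Weak duality and complementary slackness for the auxiliary dual problem. -/
theorem AuxFeasible.dualValue_le (hθ : 0 ≤ θ) (hβ : 0 ≤ β) (hc : Measurable c)
    (hm : ∀ γ, (m : EReal) ≤ c γ) (hπ₀ : IsAdmissiblePlan μ₀ μ₁ π₀)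
    (hfin : ∫⁻ γ, shiftedCost c m γ ∂π₀ ≠ ∞) {φ ψ : X → ℝ}
    (h : AuxFeasible c θ β μ₀ μ₁ π₀ φ ψ) :
    dualValue μ₀ μ₁ φ ψ ≤
      (∫⁻ γ, shiftedCost c m γ ∂π₀).toReal + m + 2 * interaction θ β π₀ π₀ ∧
    (dualValue μ₀ μ₁ φ ψ =
      (∫⁻ γ, shiftedCost c m γ ∂π₀).toReal + m + 2 * interaction θ β π₀ π₀ ↔
      ∀ᵐ γ ∂π₀, ((φ (γ 0) + ψ (γ 1) : ℝ) : EReal) =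
          c γ + ((2 * potential θ β γ π₀ : ℝ) : EReal)) := by
  have := hπ₀.1
  have hsm : Measurable (shiftedCost c m) := measurable_ereal_toENNReal.comp (hc.sub_const _)
  obtain ⟨hφ, hψ, A, hA, B, hB, hAB⟩ := h
  obtain ⟨hi, hie⟩ := hπ₀.integrable_endpoints hφ hψ
  obtain ⟨hG, hGe⟩ := integral_toReal_shiftedCost_add_potential (m := m) hθ hβ hc π₀ π₀ hfin
  rw [probReal_univ, mul_one] at hGe
  have hlt := ae_lt_top hsm hfin
  have hle : (fun γ : PathSpace X => φ (γ 0) + ψ (γ 1)) ≤ᵐ[π₀]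
      fun γ => (shiftedCost c m γ).toReal + m + 2 * potential θ β γ π₀ := by
    filter_upwards [hπ₀.ae_of_mem_ae hA hB, hlt] with γ hγ hγt
    exact le_toReal_of_coe_le hm hγt.ne (hAB γ hγ.1 hγ.2)
  rw [← hie, ← hGe]
  refine ⟨integral_mono_ae hi hG hle, ?_⟩
  rw [integral_eq_iff_of_ae_le hi hG hle]
  refine ⟨fun he => ?_, fun he => ?_⟩
  · filter_upwards [he, hlt] with γ hγ hγt
    exact (coe_eq_add_iff hm hγt.ne _ _).2 hγ
  · filter_upwards [he, hlt] with γ hγ hγt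
    exact (coe_eq_add_iff hm hγt.ne _ _).1 hγ

/-- Strong duality for the linearized problem. -/
theorem SolvesPrimal.exists_dual (hX : IsCompact X) [IsProbabilityMeasure μ₀]
    [IsProbabilityMeasure μ₁] (hc : IsCoerciveCost c) (hm : ∀ γ, (m : EReal) ≤ c γ)
    {f g : X → ℝ} (hf : Integrable f μ₀) (hg : Integrable g μ₁)
    (hfg : ∀ x y : X, endpointCost c x y ≤ ((f x + g y : ℝ) : EReal))
    (hθ : 0 ≤ θ) (hβ : 0 ≤ β) (h : SolvesPrimal c θ β μ₀ μ₁ π₀) :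
    ∫⁻ γ, shiftedCost c m γ ∂π₀ ≠ ∞ ∧
      (∃ φ ψ : X → ℝ, AuxFeasible c θ β μ₀ μ₁ π₀ φ ψ ∧
        (∫⁻ γ, shiftedCost c m γ ∂π₀).toReal + m + 2 * interaction θ β π₀ π₀ ≤
          dualValue μ₀ μ₁ φ ψ) ∧
      ∀ ε > 0, ∃ φ ψ : C(X, ℝ), (∀ γ : PathSpace X, ((φ (γ 0) + ψ (γ 1) : ℝ) : EReal) ≤
          c γ + ((2 * potential θ β γ π₀ : ℝ) : EReal)) ∧
        (∫⁻ γ, shiftedCost c m γ ∂π₀).toReal + m + 2 * interaction θ β π₀ π₀ - ε ≤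
          dualValue μ₀ μ₁ φ ψ := by
  have : CompactSpace X := isCompact_iff_compactSpace.1 hX
  have := h.1.1
  have hcm : Measurable c := hc.lowerSemicontinuous.measurable
  have hu2 : ∀ γ, 0 ≤ 2 * potential θ β γ π₀ := fun γ =>
    mul_nonneg zero_le_two (potential_nonneg hθ _ _)
  have hu2' : ∀ γ, 2 * potential θ β γ π₀ ≤ 2 * θ := fun γ => by
    have := potential_le hθ hβ γ π₀
    rw [probReal_univ, one_mul] at this
    linarith
  have hulsc : LowerSemicontinuous fun γ : PathSpace X =>
      ENNReal.ofReal (2 * potential θ β γ π₀) :=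
    (ENNReal.continuous_ofReal.comp ((continuous_potential hθ hβ π₀).const_mul 2)).lowerSemicontinuous
  set e₀ : C(PathSpace X, X) := ⟨fun γ => γ 0, by fun_prop⟩ with he₀
  set e₁ : C(PathSpace X, X) := ⟨fun γ => γ 1, by fun_prop⟩ with he₁
  obtain ⟨V, hV0, ⟨π, hπp, hπ0, hπ1, hπV⟩, happ, φ, ψ, hφ, hψ, ⟨A, hA, B, hB, hAB⟩, hVle⟩ :=
    exists_kantorovich_duality e₀ e₁ μ₀ μ₁
      (C := fun γ => shiftedCost c m γ + ENNReal.ofReal (2 * potential θ β γ π₀))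
      ((lowerSemicontinuous_shiftedCost hc.lowerSemicontinuous m).add hulsc)
      -- The constant `2 * θ - m` added to `g` absorbs the shift of the cost and the bound `2 U ≤ 2
      -- θ`, so `f` and the new `g` dominate the modified endpoint cost.
      (isCompact_shiftedCost_add_le hX hc hm hulsc) hf (hg.add (integrable_const (2 * θ - m)))
      (by
        intro x y
        have h1 : (m : EReal) ≤ endpointCost c x y := le_iInf fun γ => hm _
        have h2 := EReal.coe_le_coe_iff.1 (h1.trans (hfg x y))
        simp only [Pi.add_apply]
        linarith)
      (by
        intro x y r hr
        simp only [Pi.add_apply] at hr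
        have h1 : endpointCost c x y < ((r - 2 * θ + m : ℝ) : EReal) :=
          (hfg x y).trans_lt (EReal.coe_lt_coe_iff.2 (by linarith))
        obtain ⟨⟨γ, h0, h1'⟩, hγ⟩ := iInf_lt_iff.1 h1
        refine ⟨γ, h0, h1', ?_⟩
        rcases eq_top_or_exists_coe hm γ with h | ⟨x, hx, h⟩
        · rw [h] at hγ
          exact absurd hγ not_top_lt
        · rw [h, EReal.coe_lt_coe_iff] at hγ
          rw [shiftedCost_of_eq_coe h, ← ENNReal.ofReal_add (by linarith) (hu2 _)]
          exact ENNReal.ofReal_le_ofReal (by linarith [hu2' γ]))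
  have hπa : IsAdmissiblePlan μ₀ μ₁ π := ⟨hπp, hπ0, hπ1⟩
  rw [lintegral_shiftedCost_add_potential hθ hβ] at hπV
  have hπfin : ∫⁻ γ, shiftedCost c m γ ∂π ≠ ∞ :=
    ne_top_of_le_ne_top ENNReal.ofReal_ne_top (le_self_add.trans hπV)
  obtain ⟨hfin, hlin⟩ := h.linearized hθ hβ hcm hm hπa hπfin
  have hI0 : 0 ≤ 2 * interaction θ β π π₀ :=
    mul_nonneg zero_le_two (integral_nonneg fun γ => potential_nonneg hθ _ _)
  -- The plan from duality costs at most `V`, and by linearization `π₀` costs no more than that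
  -- plan.
  have hVge : (∫⁻ γ, shiftedCost c m γ ∂π₀).toReal + 2 * interaction θ β π₀ π₀ ≤ V := by
    refine hlin.trans ?_
    have := ENNReal.toReal_mono ENNReal.ofReal_ne_top hπV
    rwa [ENNReal.toReal_add hπfin ENNReal.ofReal_ne_top, ENNReal.toReal_ofReal hI0,
      ENNReal.toReal_ofReal hV0] at this
  -- Adding `m` to the first potential undoes the shift of the cost.
  refine ⟨hfin, ⟨fun x => φ x + m, ψ, ⟨hφ.add (integrable_const m), hψ, A, hA, B, hB,
    fun γ h0 h1 => ?_⟩, ?_⟩, fun ε hε => ?_⟩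
  · rw [coe_le_add_iff hm γ (hu2 γ)]
    convert hAB γ h0 h1 using 2
    simp only [he₀, he₁, ContinuousMap.coe_mk]
    ring
  · rw [dualValue, integral_add hφ (integrable_const m), integral_const, probReal_univ, one_smul]
    linarith
  · obtain ⟨p, hp, hpV⟩ := happ ε hε
    refine ⟨p.1 + ContinuousMap.const X m, p.2, fun γ => ?_, ?_⟩
    · rw [coe_le_add_iff hm γ (hu2 γ)]
      convert hp γ using 2
      simp [he₀, he₁]
      ring
    · rw [integralSum_apply] at hpV
      simp only [dualValue, ContinuousMap.add_apply, ContinuousMap.const_apply]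
      rw [integral_add (p.1.integrable_of_compactSpace _) (integrable_const m), integral_const,
        probReal_univ, one_smul]
      linarith

/-! ### The Lagrange dual function -/

theorem integrable_path_eval [CompactSpace X] (φ : C(X, ℝ)) (t : unitInterval)
    (π : Measure (PathSpace X)) [IsFiniteMeasure π] :
    Integrable (fun γ : PathSpace X => φ (γ t)) π :=
  ((BoundedContinuousFunction.mkOfCompact φ).compContinuous
    ⟨fun γ : PathSpace X => γ t, by fun_prop⟩).integrable π

theorem lagrangian_eq (hc : Measurable c) (hm : ∀ γ, (m : EReal) ≤ c γ) [CompactSpace X]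
    (π : Measure (PathSpace X)) [IsFiniteMeasure π] (φ ψ : C(X, ℝ)) :
    lagrangian c θ β μ₀ μ₁ π φ ψ = ((∫⁻ γ, shiftedCost c m γ ∂π : ℝ≥0∞) : EReal) +
      ((m * π.real univ + interaction θ β π π + dualValue μ₀ μ₁ φ ψ -
        ∫ γ, (φ (γ 0) + ψ (γ 1)) ∂π : ℝ) : EReal) := by
  rw [lagrangian, interactionFunctional_eq hc hm, add_assoc, ← EReal.coe_add,
    integral_add (integrable_path_eval φ 0 π)
      (integrable_path_eval ψ 1 π), dualValue]
  congr 2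
  ring

/-- The Lagrange dual function at a pair that satisfies the constraint of the auxiliary dual
problem everywhere. -/
theorem le_dualFunction (hθ : 0 ≤ θ) (hβ : 0 ≤ β) (hc : Measurable c)
    (hm : ∀ γ, (m : EReal) ≤ c γ) [CompactSpace X] [IsFiniteMeasure π₀] {φ ψ : C(X, ℝ)}
    (h : ∀ γ : PathSpace X, ((φ (γ 0) + ψ (γ 1) : ℝ) : EReal) ≤
          c γ + ((2 * potential θ β γ π₀ : ℝ) : EReal)) :
    ((dualValue μ₀ μ₁ φ ψ - interaction θ β π₀ π₀ : ℝ) : EReal) ≤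
      dualFunction c θ β μ₀ μ₁ φ ψ := by
  refine le_iInf fun π => ?_
  rw [lagrangian_eq hc hm]
  rcases eq_or_ne (∫⁻ γ, shiftedCost c m γ ∂(π : Measure (PathSpace X))) ∞ with htop | hfin
  · rw [htop, EReal.coe_ennreal_top, EReal.top_add_coe]
    exact le_top
  rw [coe_ennreal_eq_coe_toReal hfin, ← EReal.coe_add, EReal.coe_le_coe_iff]
  have hsm : Measurable (shiftedCost c m) := measurable_ereal_toENNReal.comp (hc.sub_const _)
  obtain ⟨hG, hGe⟩ := integral_toReal_shiftedCost_add_potential (m := m) hθ hβ hc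
    (π : Measure (PathSpace X)) π₀ hfin
  have hle : ∫ γ, (φ (γ 0) + ψ (γ 1)) ∂(π : Measure (PathSpace X)) ≤ _ :=
    integral_mono_ae ((integrable_path_eval φ 0 _).add
      (integrable_path_eval ψ 1 _)) hG (by
      filter_upwards [ae_lt_top hsm hfin] with γ hγ
      exact le_toReal_of_coe_le hm hγ.ne (h γ))
  rw [hGe] at hle
  -- Semidefiniteness replaces the quadratic term by its tangent at `π₀`. It holds for measures of
  -- any finite mass, as the infimum over all `π ≥ 0` requires.
  have hpsd := two_mul_interaction_le hθ hβ (π : Measure (PathSpace X)) π₀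
  linarith

/-- A pair of continuous functions at which the Lagrangian is bounded below by the value of the
primal problem satisfies the constraint and is optimal for the auxiliary dual problem. -/
theorem auxFeasible_of_lagrangian_ge (hθ : 0 ≤ θ) (hβ : 0 ≤ β) (hc : Measurable c)
    (hm : ∀ γ, (m : EReal) ≤ c γ) [CompactSpace X] [IsFiniteMeasure μ₀] [IsFiniteMeasure μ₁]
    (hπ₀ : IsAdmissiblePlan μ₀ μ₁ π₀)
    (hfin : ∫⁻ γ, shiftedCost c m γ ∂π₀ ≠ ∞) {φ ψ : C(X, ℝ)}
    (h : ∀ π : FiniteMeasure (PathSpace X),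
      (((∫⁻ γ, shiftedCost c m γ ∂π₀).toReal + m + interaction θ β π₀ π₀ : ℝ) : EReal) ≤
        lagrangian c θ β μ₀ μ₁ π φ ψ) :
    AuxFeasible c θ β μ₀ μ₁ π₀ φ ψ ∧
      (∫⁻ γ, shiftedCost c m γ ∂π₀).toReal + m + 2 * interaction θ β π₀ π₀ ≤
        dualValue μ₀ μ₁ φ ψ := by
  have := hπ₀.1
  have hsm : Measurable (shiftedCost c m) := measurable_ereal_toENNReal.comp (hc.sub_const _)
  have hφ := φ.integrable_of_compactSpace μ₀
  have hψ := ψ.integrable_of_compactSpace μ₁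
  obtain ⟨hi, hie⟩ := hπ₀.integrable_endpoints hφ hψ
  set s := (∫⁻ γ, shiftedCost c m γ ∂π₀).toReal with hs
  set I := interaction θ β π₀ π₀ with hI
  set D := dualValue μ₀ μ₁ φ ψ with hD
  -- The lower bound evaluated at `a π₀ + b ρ`, a quadratic polynomial in the two weights.
  have key : ∀ (ρ : Measure (PathSpace X)) [IsProbabilityMeasure ρ],
      ∫⁻ γ, shiftedCost c m γ ∂ρ ≠ ∞ → ∀ a b : ℝ≥0,
      s + m + I ≤ a * s + b * (∫⁻ γ, shiftedCost c m γ ∂ρ).toReal + m * (a + b) +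
        (a ^ 2 * I + 2 * a * b * interaction θ β π₀ ρ + b ^ 2 * interaction θ β ρ ρ) + D -
        (a * D + b * ∫ γ, (φ (γ 0) + ψ (γ 1)) ∂ρ) := by
    intro ρ _ hρ a b
    have hle : _ ≤ lagrangian c θ β μ₀ μ₁ (a • π₀ + b • ρ) φ ψ :=
      h ⟨a • π₀ + b • ρ, inferInstance⟩
    obtain ⟨hf, hr⟩ := toReal_lintegral_shiftedCost_combo (m := m) hfin hρ a b
    have hiρ : Integrable (fun γ : PathSpace X => φ (γ 0) + ψ (γ 1)) ρ :=
      (integrable_path_eval φ 0 _).add (integrable_path_eval ψ 1 _)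
    have hmass : (a • π₀ + b • ρ).real univ = a + b := by
      simp [measureReal_add_apply]
    rw [lagrangian_eq hc hm, coe_ennreal_eq_coe_toReal hf,
      ← EReal.coe_add, EReal.coe_le_coe_iff, hr, interaction_combo_self hθ hβ, hmass,
      integral_add_measure hi.smul_measure_nnreal hiρ.smul_measure_nnreal,
      integral_smul_nnreal_measure, integral_smul_nnreal_measure, hie, NNReal.smul_def,
      NNReal.smul_def, smul_eq_mul, smul_eq_mul] at hle
    linarith
  refine ⟨⟨hφ, hψ, univ, univ_mem, univ, univ_mem, fun γ _ _ => ?_⟩, ?_⟩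
  · rcases eq_top_or_exists_coe hm γ with htop | ⟨x, hx, hcx⟩
    · rw [htop, EReal.top_add_coe]
      exact le_top
    have hdir : ∫⁻ σ, shiftedCost c m σ ∂(Measure.dirac γ) = ENNReal.ofReal (x - m) := by
      rw [lintegral_dirac' _ hsm, shiftedCost_of_eq_coe hcx]
    have hdirφ : ∫ σ : PathSpace X, (φ (σ 0) + ψ (σ 1)) ∂(Measure.dirac γ) = φ (γ 0) + ψ (γ 1) :=
      integral_dirac' _ _ (by fun_prop :
        Continuous fun σ : PathSpace X => φ (σ 0) + ψ (σ 1)).stronglyMeasurable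
    rw [hcx, ← EReal.coe_add, EReal.coe_le_coe_iff, ← sub_nonneg]
    -- Along `π₀ + t δ_γ` the linear coefficient is the slack of the constraint at `γ`.
    refine nonneg_of_forall_mul_add_sq_mul_nonneg
      (r := interaction θ β (Measure.dirac γ) (Measure.dirac γ)) fun t ht0 _ => ?_
    lift t to ℝ≥0 using ht0.le
    have := key (Measure.dirac γ) (by rw [hdir]; exact ENNReal.ofReal_ne_top) 1 t
    rw [hdir, ENNReal.toReal_ofReal (by linarith), hdirφ, interaction_comm hθ hβ π₀,
      interaction_dirac_left hθ hβ] at this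
    simp only [NNReal.coe_one] at this
    linarith
  · rw [← sub_nonneg]
    -- Along `(1 - t) π₀` the linear coefficient is the dual value minus `E(π₀)`. Here the total
    -- mass has to vary.
    refine nonneg_of_forall_mul_add_sq_mul_nonneg (r := I) fun t ht0 ht1 => ?_
    lift t to ℝ≥0 using ht0.le
    have ht1' : t ≤ 1 := by exact_mod_cast ht1.le
    have := key π₀ hfin (1 - t) 0
    simp only [NNReal.coe_sub ht1', NNReal.coe_one, NNReal.coe_zero] at this
    linarith

end PathTransport

theorem mainTheorem8 {n : ℕ} {X : Set (EuclideanSpace ℝ (Fin n))} (hX : IsCompact X)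
    (μ₀ μ₁ : MeasureTheory.Measure X)
    [MeasureTheory.IsProbabilityMeasure μ₀] [MeasureTheory.IsProbabilityMeasure μ₁]
    (c : PathTransport.PathSpace X → EReal) (hc : PathTransport.IsCoerciveCost c)
    (f g : X → ℝ) (hf : MeasureTheory.Integrable f μ₀) (hg : MeasureTheory.Integrable g μ₁)
    (hfg : ∀ x y : X, PathTransport.endpointCost c x y ≤ ((f x + g y : ℝ) : EReal))
    (θ β : ℝ) (hθ : 0 < θ) (hβ : 0 < β)
    (π₀ : MeasureTheory.Measure (PathTransport.PathSpace X))
    (hπ₀ : PathTransport.SolvesPrimal c θ β μ₀ μ₁ π₀) :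
    -- the auxiliary dual problem of `π₀` has a solution
    (∃ φ₀ ψ₀ : X → ℝ, PathTransport.SolvesAuxDual c θ β μ₀ μ₁ π₀ φ₀ ψ₀) ∧
    -- its value is the energy of `π₀`
    (∀ φ₀ ψ₀ : X → ℝ, PathTransport.SolvesAuxDual c θ β μ₀ μ₁ π₀ φ₀ ψ₀ →
      ((PathTransport.dualValue μ₀ μ₁ φ₀ ψ₀ : ℝ) : EReal) = PathTransport.energy c θ β π₀) ∧
    -- a feasible pair is a solution iff the constraint is an equality along `π₀`
    (∀ φ₀ ψ₀ : X → ℝ, PathTransport.AuxFeasible c θ β μ₀ μ₁ π₀ φ₀ ψ₀ →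
      (PathTransport.SolvesAuxDual c θ β μ₀ μ₁ π₀ φ₀ ψ₀ ↔
        ∀ᵐ γ ∂π₀, ((φ₀ (γ 0) + ψ₀ (γ 1) : ℝ) : EReal) =
          c γ + ((2 * PathTransport.potential θ β γ π₀ : ℝ) : EReal))) ∧
    -- every maximizer of the Lagrange dual function is a solution
    (∀ φ₀ ψ₀ : C(X, ℝ), PathTransport.SolvesDual c θ β μ₀ μ₁ φ₀ ψ₀ →
      PathTransport.SolvesAuxDual c θ β μ₀ μ₁ π₀ φ₀ ψ₀) := by
  obtain ⟨m, hm⟩ := hc.bounded_below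
  have hcm : Measurable c := hc.lowerSemicontinuous.measurable
  have : CompactSpace X := isCompact_iff_compactSpace.1 hX
  have := hπ₀.1.1
  obtain ⟨hfin, ⟨φ, ψ, hfeas, hopt⟩, happ⟩ :=
    hπ₀.exists_dual hX hc hm hf hg hfg hθ.le hβ.le
  have hweak := fun (φ' ψ' : X → ℝ)
    (h : PathTransport.AuxFeasible c θ β μ₀ μ₁ π₀ φ' ψ') =>
      h.dualValue_le hθ.le hβ.le hcm hm hπ₀.1 hfin
  have hsol : ∀ φ' ψ' : X → ℝ, PathTransport.AuxFeasible c θ β μ₀ μ₁ π₀ φ' ψ' →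
      (PathTransport.SolvesAuxDual c θ β μ₀ μ₁ π₀ φ' ψ' ↔
        PathTransport.dualValue μ₀ μ₁ φ' ψ' =
          (∫⁻ γ, PathTransport.shiftedCost c m γ ∂π₀).toReal + m +
            2 * PathTransport.interaction θ β π₀ π₀) := fun φ' ψ' h =>
    ⟨fun hs => (hweak _ _ h).1.antisymm (hopt.trans (hs.2 _ _ hfeas)),
      fun he => ⟨h, fun _ _ h' => he ▸ (hweak _ _ h').1⟩⟩
  refine ⟨⟨φ, ψ, (hsol _ _ hfeas).2 ((hweak _ _ hfeas).1.antisymm hopt)⟩, fun φ₀ ψ₀ hs => ?_,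
    fun φ₀ ψ₀ h => (hsol _ _ h).trans (hweak _ _ h).2, fun φ₀ ψ₀ hmax => ?_⟩
  · rw [(hsol _ _ hs.1).1 hs, PathTransport.energy_eq hcm hm,
      PathTransport.coe_ennreal_eq_coe_toReal hfin, ← EReal.coe_add,
      MeasureTheory.probReal_univ, mul_one, add_assoc]
  · obtain ⟨hf₀, hv₀⟩ := PathTransport.auxFeasible_of_lagrangian_ge hθ.le hβ.le hcm hm hπ₀.1 hfin
      (φ := φ₀) (ψ := ψ₀) (fun π => by
        -- Continuous pairs only approach the dual value, so the bound `F(π₀)` is reached through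
        -- every real `z` below it, with tolerance `F(π₀) - z`.
        refine EReal.ge_of_forall_gt_iff_ge.1 fun z hz => ?_
        obtain ⟨φ', ψ', h', hv'⟩ := happ _ (sub_pos.2 (EReal.coe_lt_coe_iff.1 hz))
        have h1 := PathTransport.le_dualFunction (μ₀ := μ₀) (μ₁ := μ₁) hθ.le hβ.le hcm hm h'
        refine le_trans (EReal.coe_le_coe_iff.2 ?_) (h1.trans ((hmax φ' ψ').trans (iInf_le _ π)))
        linarith)
    exact (hsol _ _ hf₀).2 ((hweak _ _ hf₀).1.antisymm hv₀)
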